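/- Let $W$ be a $\mathbb{Z}/2\mathbb{Z}$-homology sphere, that is, a closed connected 3-manifold with $H_*(W;\mathbb{Z}/2\mathbb{Z})\cong H_*(S^3;\mathbb{Z}/2\mathbb{Z})$. Let $K\subset W$ be a tame knot, and let $M$ be its complement, that is, the compact 3-manifold with torus boundary obtained from $W$ by removing an open tubular neighborhood of $K$. Suppose that $M$ fibers over $S^1$, that is, $M$ is the total space of a locally trivial fiber bundle over $S^1$ whose fiber is a compact surface. Then every representation $\rho\colon \pi_1(M)\to \mathrm{PSL}(2,\mathbb{C})$ that is reducible (its image fixes a point of $\mathbb{CP}^1$) and has non-abelian image is integral: for every $\gamma\in\pi_1(M)$ the trace of $\rho(\gamma)$, which is well defined up to sign, is an algebraic integer. -/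

import Mathlib

universe u

/-- The `n`-th singular homology group `H_n(X; ℤ/2)`, as a `ℤ/2`-module.
(The coefficient module is `ULift`ed so that `X` may live in any universe.) -/
noncomputable def HomologyModTwo (n : ℕ) (X : Type u) [TopologicalSpace X] :
    ModuleCat.{u} (ZMod 2) :=
  ((AlgebraicTopology.singularHomologyFunctor (ModuleCat.{u} (ZMod 2)) n).obj
    (ModuleCat.of (ZMod 2) (ULift.{u} (ZMod 2)))).obj (TopCat.of X)

/-- A `ℤ/2`-homology 3-sphere: a closed connected 3-manifold `W` with
`H_0(W; ℤ/2) ≅ H_3(W; ℤ/2) ≅ ℤ/2` and `H_n(W; ℤ/2) = 0` for all other `n`. -/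
structure IsModTwoHomologyThreeSphere (W : Type u) [TopologicalSpace W] : Prop where
  t2 : T2Space W
  compact : CompactSpace W
  connected : ConnectedSpace W
  manifold : Nonempty (ChartedSpace (EuclideanSpace ℝ (Fin 3)) W)
  homology_zero : Nonempty (HomologyModTwo 0 W ≃ₗ[ZMod 2] ZMod 2)
  homology_three : Nonempty (HomologyModTwo 3 W ≃ₗ[ZMod 2] ZMod 2)
  homology_other : ∀ n : ℕ, n ≠ 0 → n ≠ 3 → Subsingleton (HomologyModTwo n W)

/-- A (product) tubular neighbourhood `S¹ × ℝ²` of a knot `K` in a 3-manifold `W`.  Its existence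
says that `K` is an embedded circle which is tame; in an orientable 3-manifold every tame knot has
such a neighbourhood. -/
structure KnotTube {W : Type u} [TopologicalSpace W] (K : Set W) where
  /-- the parametrisation of the neighbourhood by `S¹ × ℂ` -/
  toFun : Circle × ℂ → W
  isOpenEmbedding : Topology.IsOpenEmbedding toFun
  image_core : toFun '' {q | q.2 = 0} = K

/-- The knot complement, as the compact manifold with torus boundary obtained by removing from `W`
the open solid torus `S¹ × {|z| < 1}` around `K`. -/
def KnotTube.complement {W : Type u} [TopologicalSpace W] {K : Set W} (N : KnotTube K) : Set W :=
  (N.toFun '' {q | ‖q.2‖ < 1})ᶜ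

/-- `M` fibers over `S¹`: it is the total space of a locally trivial fiber bundle over the circle
whose fiber is a compact surface (possibly with boundary). -/
def FibersOverCircle (M : Type u) [TopologicalSpace M] : Prop :=
  ∃ (F : Type u) (_ : TopologicalSpace F) (p : M → Circle),
    T2Space F ∧ CompactSpace F ∧ Nonempty (ChartedSpace (EuclideanHalfSpace 2) F) ∧
    ∀ b : Circle, ∃ e : Bundle.Trivialization F p, b ∈ e.baseSet

/-- `PSL(2, ℂ)`. -/
abbrev PSLTwoC : Type := Matrix.ProjectiveSpecialLinearGroup (Fin 2) ℂ

/-- The representation has non-abelian image. -/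
def IsNonabelianRep {G : Type*} [Group G] (ρ : G →* PSLTwoC) : Prop :=
  ∃ g h : G, ρ g * ρ h ≠ ρ h * ρ g

/-- The representation is reducible: it fixes a point of `ℂP¹`, that is, it can be conjugated into
the upper triangular matrices. -/
def IsReducibleRep {G : Type*} [Group G] (ρ : G →* PSLTwoC) : Prop :=
  ∃ L : Projectivization ℂ (Fin 2 → ℂ), ∀ g : G, ρ g • L = L

/-- The representation is integral: the trace of every `ρ g`, which is well defined up to sign
(as the trace of any lift `A` to `SL(2, ℂ)`), is an algebraic integer. -/
def IsIntegralRep {G : Type*} [Group G] (ρ : G →* PSLTwoC) : Prop :=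
  ∀ (g : G) (A : Matrix.SpecialLinearGroup (Fin 2) ℂ),
    (QuotientGroup.mk A : PSLTwoC) = ρ g → IsIntegral ℤ (Matrix.trace (A : Matrix (Fin 2) (Fin 2) ℂ))

/-!
A reducible representation `ρ` is, up to signs, an action by affine maps `z ↦ χ(g) z + τ(g)` of `ℂ`,
and the traces are `± (a + a⁻¹)` with `a² = χ(g)`; so it suffices that all `χ(g)` are algebraic
integers. Let `P` be the kernel of the homomorphism from the fundamental group of the complement to
`ℤ` given by the fibration. It is the image of the fundamental group of the compact fiber, hence
finitely generated (`exists_hom_int_fg_ker`). If `χ` has finite exponent on `P`, then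
`P ∩ ker χ` has finite index in `P`, so it is finitely generated, too. The translations
`τ(P ∩ ker χ)` form a finitely generated subgroup of `ℂ` which is stable under multiplication by
each `χ(g)`, by conjugation, and which is nonzero because it contains the translations of the
commutators and `ρ` is not abelian. So `χ(g)` is integral (`isIntegral_of_affine_not_commute`).

That `χ` has finite exponent on `P` follows if the meridian `μ` is killed by no nontrivial
homomorphism to `ℤ/2` (`exists_pow_eq_one_of_mem_ker`): projecting along a section of the map to
`ℤ`, and correcting by the reduction of this map modulo two, one extends a homomorphism
`χ(P) → ℤ/2` to one of the whole group that kills `μ`. So the finitely generated abelian group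
`χ(P)` has no homomorphism to `ℤ/2`, and is finite of odd order.

The property of the meridian (`KnotTube.exists_meridian`) is the only use of the homology of `W`,
and needs only `H₁(W; ℤ/2) = 0`. Classes in `H¹` are encoded as functions on paths (`PathCocycle`).
A class of the knot complement with coefficients in `ℤ/2` that vanishes on `μ` is, near the boundary
torus, the pullback of a class of the longitude up to a coboundary, so it extends over the solid
torus. The extension has local potentials (`LocalPotentials`). These have a primitive along each
singular simplex, as simplices are simply connected and the primitives are the sections of a
covering space; the changes of the primitives along the singular one-simplices form a singular
cocycle. As `H₁(W; ℤ/2) = 0`, it vanishes on loops (`PathCocycle.eq_zero_of_agree`).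
-/

open Topology unitInterval

/-! ### Reducible representations as affine actions -/

/-- Two matrices of `SL(2, ℂ)` have the same class in `PSL(2, ℂ)` iff they agree up to sign. -/
theorem pslTwoC_mk_eq_iff (A B : Matrix.SpecialLinearGroup (Fin 2) ℂ) :
    (QuotientGroup.mk A : PSLTwoC) = QuotientGroup.mk B ↔ B = A ∨ B = -A := by
  rw [QuotientGroup.eq, Matrix.SpecialLinearGroup.mem_center_iff]
  constructor
  · rintro ⟨r, hr, h⟩
    have hB : (B : Matrix (Fin 2) (Fin 2) ℂ) = r • (A : Matrix (Fin 2) (Fin 2) ℂ) := by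
      have h1 : B = A * (A⁻¹ * B) := by group
      rw [h1, Matrix.SpecialLinearGroup.coe_mul, ← h]
      ext i j
      simp [Matrix.scalar_apply, mul_comm]
    have hr' : r = 1 ∨ r = -1 := by
      rw [Fintype.card_fin] at hr
      exact eq_or_eq_neg_of_sq_eq_sq r 1 (by rw [hr, one_pow])
    rcases hr' with rfl | rfl
    · left; ext i j; rw [hB]; simp
    · right; ext i j; rw [hB]; simp
  · rintro (rfl | rfl)
    · exact ⟨1, by simp, by simp⟩
    · refine ⟨-1, by simp, ?_⟩
      rw [mul_neg, inv_mul_cancel]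
      ext i j
      by_cases hij : i = j <;> simp [Matrix.scalar_apply, hij]

/-- A nonzero vector of `ℂ²` is the first column of a matrix of determinant one. -/
theorem exists_specialLinearGroup_firstColumn (v : Fin 2 → ℂ) (hv : v ≠ 0) :
    ∃ B : Matrix.SpecialLinearGroup (Fin 2) ℂ, ∀ i, B i 0 = v i := by
  by_cases h0 : v 0 = 0
  · have h1 : v 1 ≠ 0 := by
      intro h1
      exact hv (by ext i; fin_cases i <;> simp [h0, h1])
    refine ⟨⟨!![v 0, -(v 1)⁻¹; v 1, 0], by simp [Matrix.det_fin_two, h1]⟩, ?_⟩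
    intro i; fin_cases i <;> simp
  · refine ⟨⟨!![v 0, 0; v 1, (v 0)⁻¹], by simp [Matrix.det_fin_two, h0]⟩, ?_⟩
    intro i; fin_cases i <;> simp

/-- A reducible representation into `PSL(2, ℂ)` is an action by affine transformations
`z ↦ χ(g) z + τ(g)` of `ℂ`: in a basis starting with the fixed line, a lift of `ρ g` is
`±!![a, b; 0, a⁻¹]`, and `χ g = a²`, `τ g = a b` do not depend on the sign. -/
theorem exists_affine_of_isReducibleRep {G : Type*} [Group G] (ρ : G →* PSLTwoC)
    (hred : IsReducibleRep ρ) :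
    ∃ (χ : G →* ℂˣ) (τ : G → ℂ), (∀ g h, τ (g * h) = χ g * τ h + τ g) ∧
      (∀ g h, χ g = χ h → τ g = τ h → ρ g = ρ h) ∧
      ∀ (g : G) (A : Matrix.SpecialLinearGroup (Fin 2) ℂ), (QuotientGroup.mk A : PSLTwoC) = ρ g →
        ∃ a : ℂ, a ^ 2 = χ g ∧ Matrix.trace (A : Matrix (Fin 2) (Fin 2) ℂ) = a + a⁻¹ := by
  classical
  obtain ⟨L, hL⟩ := hred
  induction L using Projectivization.ind with
  | h v hv =>
  obtain ⟨B, hB⟩ := exists_specialLinearGroup_firstColumn v hv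
  -- in the new basis every lift is upper triangular
  have hup : ∀ (g : G) (A : Matrix.SpecialLinearGroup (Fin 2) ℂ),
      (QuotientGroup.mk A : PSLTwoC) = ρ g → (B⁻¹ * A * B) 1 0 = 0 := by
    intro g A hA
    have h1 := hL g
    rw [← hA] at h1
    have h2 : A • Projectivization.mk ℂ v hv = Projectivization.mk ℂ v hv := h1
    rw [Projectivization.smul_mk, Projectivization.mk_eq_mk_iff'] at h2
    obtain ⟨c, hc⟩ := h2
    have h3 : (A : Matrix (Fin 2) (Fin 2) ℂ).mulVec v = c • v := hc.symm
    have e0 := congrFun h3 0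
    have e1 := congrFun h3 1
    simp only [Matrix.mulVec, dotProduct, Fin.sum_univ_two, Pi.smul_apply, smul_eq_mul,
      ← hB] at e0 e1
    simp only [Matrix.SpecialLinearGroup.coe_mul, Matrix.SpecialLinearGroup.coe_inv,
      Matrix.adjugate_fin_two, Matrix.mul_apply, Fin.sum_univ_two, Matrix.of_apply,
      Matrix.cons_val', Matrix.cons_val_zero, Matrix.cons_val_one, Matrix.cons_val_fin_one]
    linear_combination (-B 1 0) * e0 + B 0 0 * e1
  choose A hA using fun g => QuotientGroup.mk_surjective (ρ g)
  set C : G → Matrix.SpecialLinearGroup (Fin 2) ℂ := fun g => B⁻¹ * A g * B with hC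
  have hC10 : ∀ g, C g 1 0 = 0 := fun g => hup g _ (hA g)
  have hdet : ∀ g, C g 0 0 * C g 1 1 = 1 := by
    intro g
    have := (C g).det_coe
    rw [Matrix.det_fin_two, hC10] at this
    simpa using this
  have hmk : ∀ g (A' : Matrix.SpecialLinearGroup (Fin 2) ℂ), (QuotientGroup.mk A' : PSLTwoC) = ρ g →
      B⁻¹ * A' * B = C g ∨ B⁻¹ * A' * B = -C g := by
    intro g A' h
    rcases (pslTwoC_mk_eq_iff _ _).mp ((hA g).trans h.symm) with h | h
    · left; rw [h]
    · right; rw [h]; simp [hC]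
  have hmul : ∀ g h, C g * C h = C (g * h) ∨ C g * C h = -C (g * h) := by
    intro g h
    have := hmk (g * h) (A g * A h) (by rw [QuotientGroup.mk_mul, hA, hA, map_mul])
    have e : B⁻¹ * (A g * A h) * B = C g * C h := by simp only [hC]; group
    rwa [e] at this
  have hmul00 : ∀ g h, (C g * C h) 0 0 = C g 0 0 * C h 0 0 := by
    intro g h
    simp [Matrix.SpecialLinearGroup.coe_mul, Matrix.mul_apply, Fin.sum_univ_two, hC10]
  have hmul01 : ∀ g h, (C g * C h) 0 1 = C g 0 0 * C h 0 1 + C g 0 1 * C h 1 1 := by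
    intro g h
    simp [Matrix.SpecialLinearGroup.coe_mul, Matrix.mul_apply, Fin.sum_univ_two]
  have hχ : ∀ g h, (C (g * h) 0 0) ^ 2 = (C g 0 0) ^ 2 * (C h 0 0) ^ 2 := by
    intro g h
    rw [← mul_pow, ← hmul00]
    rcases hmul g h with e | e <;> simp [e]
  have hχ1 : (C 1 0 0) ^ 2 = 1 := by
    have := hχ 1 1
    rw [mul_one] at this
    have hne : (C 1 0 0) ^ 2 ≠ 0 := pow_ne_zero _ (left_ne_zero_of_mul_eq_one (hdet 1))
    exact mul_left_cancel₀ hne (by rw [← this, mul_one])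
  let χ₀ : G →* ℂ := ⟨⟨fun g => (C g 0 0) ^ 2, hχ1⟩, hχ⟩
  refine ⟨χ₀.toHomUnits, fun g => C g 0 0 * C g 0 1, ?_, ?_, ?_⟩
  · intro g h
    change C (g * h) 0 0 * C (g * h) 0 1
      = (C g 0 0) ^ 2 * (C h 0 0 * C h 0 1) + C g 0 0 * C g 0 1
    have e : C (g * h) 0 0 * C (g * h) 0 1 = (C g * C h) 0 0 * (C g * C h) 0 1 := by
      rcases hmul g h with e | e <;> simp [e]
    rw [e, hmul00, hmul01]
    linear_combination (C g 0 0 * C g 0 1) * hdet h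
  · intro g h h1 (h2 : C g 0 0 * C g 0 1 = C h 0 0 * C h 0 1)
    have h1' : (C g 0 0) ^ 2 = (C h 0 0) ^ 2 := congrArg Units.val h1
    have key : C h = C g ∨ C h = -C g := by
      rcases sq_eq_sq_iff_eq_or_eq_neg.mp h1' with e | e
      · left
        have n0 : C h 0 0 ≠ 0 := left_ne_zero_of_mul_eq_one (hdet h)
        have e11 : C h 1 1 = C g 1 1 :=
          mul_left_cancel₀ n0 (by rw [hdet, ← e, hdet])
        have e01 : C h 0 1 = C g 0 1 := mul_left_cancel₀ n0 (h2.symm.trans (by rw [e]))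
        ext i j
        fin_cases i <;> fin_cases j
        · exact e.symm
        · exact e01
        · exact (hC10 h).trans (hC10 g).symm
        · exact e11
      · right
        have n0 : C h 0 0 ≠ 0 := left_ne_zero_of_mul_eq_one (hdet h)
        have e11 : C h 1 1 = -C g 1 1 :=
          mul_left_cancel₀ n0 ((hdet h).trans ((hdet g).symm.trans (by rw [e]; ring)))
        have e01 : C h 0 1 = -C g 0 1 := mul_left_cancel₀ n0 (h2.symm.trans (by rw [e]; ring))
        ext i j
        rw [Matrix.SpecialLinearGroup.coe_neg]
        fin_cases i <;> fin_cases j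
        · simp [e]
        · exact e01
        · change C h 1 0 = -C g 1 0
          rw [hC10, hC10, neg_zero]
        · exact e11
    rw [← hA g, ← hA h, pslTwoC_mk_eq_iff]
    have hAC : ∀ g, A g = B * C g * B⁻¹ := fun g => by simp only [hC]; group
    rcases key with e | e
    · left; rw [hAC, hAC g, e]
    · right; rw [hAC, hAC g, e]; simp
  · intro g A' h
    have htr : Matrix.trace (A' : Matrix (Fin 2) (Fin 2) ℂ)
        = (B⁻¹ * A' * B) 0 0 + (B⁻¹ * A' * B) 1 1 := by
      have e : Matrix.trace ((B⁻¹ * A' * B : Matrix.SpecialLinearGroup (Fin 2) ℂ) :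
          Matrix (Fin 2) (Fin 2) ℂ) = Matrix.trace (A' : Matrix (Fin 2) (Fin 2) ℂ) := by
        rw [mul_assoc, Matrix.SpecialLinearGroup.coe_mul, Matrix.trace_mul_comm,
          ← Matrix.SpecialLinearGroup.coe_mul, mul_assoc, mul_inv_cancel, mul_one]
      rw [← e, Matrix.trace_fin_two]
    have h11 : C g 1 1 = (C g 0 0)⁻¹ := eq_inv_of_mul_eq_one_right (hdet g)
    rcases hmk g A' h with e | e
    · exact ⟨C g 0 0, rfl, by rw [htr, e, h11]⟩
    · refine ⟨-C g 0 0, neg_sq _, ?_⟩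
      rw [htr, e, inv_neg, ← h11]
      simp

/-! ### The group-theoretic part of the argument -/

/-- A finitely generated abelian group without nontrivial homomorphism to `ℤ/2` is of finite
exponent. -/
theorem exists_pow_eq_one_of_forall_hom_zmod_two_trivial {B : Type*} [CommGroup B] [Group.FG B]
    (h : ∀ f : B →* Multiplicative (ZMod 2), f = 1) : ∃ n : ℕ, n ≠ 0 ∧ ∀ b : B, b ^ n = 1 := by
  -- the quotient by squares is a vector space over `ℤ/2` without linear forms
  have hsq : ∀ b : B, ∃ c : B, c ^ 2 = b := by
    by_contra! hcon
    obtain ⟨b, hb⟩ := hcon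
    let S : Subgroup B := (powMonoidHom 2 : B →* B).range
    let Q := Additive (B ⧸ S)
    have hQ : ∀ q : Q, 2 • q = 0 := by
      intro q
      obtain ⟨x, hx⟩ := QuotientGroup.mk_surjective (Additive.toMul q)
      apply Additive.toMul.injective
      change (Additive.toMul q) ^ 2 = 1
      rw [← hx, ← QuotientGroup.mk_pow, QuotientGroup.eq_one_iff]
      exact ⟨x, rfl⟩
    let _ : Module (ZMod 2) Q := AddCommGroup.zmodModule hQ
    let q : Q := Additive.ofMul (QuotientGroup.mk b)
    have hq : q ≠ 0 := by
      intro h0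
      have : (QuotientGroup.mk b : B ⧸ S) = 1 := h0
      rw [QuotientGroup.eq_one_iff] at this
      obtain ⟨c, hc⟩ := this
      exact hb c hc
    obtain ⟨f, hf⟩ := Module.Projective.exists_dual_ne_zero (ZMod 2) hq
    let F : B →* Multiplicative (ZMod 2) :=
      (AddMonoidHom.toMultiplicative (f : Q →ₗ[ZMod 2] ZMod 2).toAddMonoidHom).comp
        ((MulEquiv.multiplicativeAdditive (B ⧸ S)).symm.toMonoidHom.comp (QuotientGroup.mk' S))
    have hF : F b = 1 := by rw [h F]; rfl
    exact hf hF
  have hfg : (⊤ : Submodule ℤ (Additive B)).FG := by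
    rw [← Module.finite_def, Module.Finite.iff_addGroup_fg]
    infer_instance
  obtain ⟨r, hr, hr0⟩ := Submodule.exists_sub_one_mem_and_smul_eq_zero_of_fg_of_le_smul
    (Ideal.span {(2 : ℤ)}) (⊤ : Submodule ℤ (Additive B)) hfg (by
      intro b _
      obtain ⟨c, hc⟩ := hsq b.toMul
      have : b = (2 : ℤ) • (Additive.ofMul c) := by
        apply Additive.toMul.injective
        rw [← hc, toMul_zsmul, toMul_ofMul]
        exact (zpow_natCast c 2).symm
      rw [this]
      exact Submodule.smul_mem_smul (Ideal.mem_span_singleton_self 2) trivial)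
  have hr' : r ≠ 0 := by
    rintro rfl
    rw [Ideal.mem_span_singleton] at hr
    omega
  refine ⟨r.natAbs, Int.natAbs_ne_zero.mpr hr', fun b => ?_⟩
  have h1 : b ^ r = 1 := hr0 (Additive.ofMul b) trivial
  rcases Int.natAbs_eq r with e | e
  · rw [e, zpow_natCast] at h1; exact h1
  · rw [e, zpow_neg, zpow_natCast, inv_eq_one] at h1; exact h1

/-- If `G → ℤ` is nontrivial with finitely generated kernel `P` and if there is `μ ∈ G` such that
only the trivial homomorphism `G → ℤ/2` kills `μ`, then every homomorphism from `G` to an abelian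
group has finite exponent on `P`: the abelianization of `G` has rank one, and only odd torsion. -/
theorem exists_pow_eq_one_of_mem_ker {G A : Type*} [Group G] [CommGroup A]
    (ε : G →* Multiplicative ℤ) (hε : ε ≠ 1) [Group.FG ε.ker] (μ : G)
    (hμ : ∀ f : G →* Multiplicative (ZMod 2), f μ = 1 → f = 1) (χ : G →* A) :
    ∃ n : ℕ, n ≠ 0 ∧ ∀ p ∈ ε.ker, χ p ^ n = 1 := by
  -- the image of `ε` is infinite cyclic; `t` maps to a generator
  obtain ⟨⟨_, t, rfl⟩, ht⟩ := IsCyclic.exists_generator (α := ε.range)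
  have hgen : ∀ g, ∃ k : ℤ, ε g = ε t ^ k := by
    intro g
    obtain ⟨k, hk⟩ := Subgroup.mem_zpowers_iff.mp (ht ⟨ε g, g, rfl⟩)
    exact ⟨k, (congrArg Subtype.val hk).symm⟩
  have ht1 : ε t ≠ 1 := by
    intro h
    apply hε
    ext1 g
    obtain ⟨k, hk⟩ := hgen g
    rw [hk, h, one_zpow, MonoidHom.one_apply]
  have hinj : ∀ k l : ℤ, ε t ^ k = ε t ^ l → k = l := by
    intro k l hkl
    have h1 : k * (ε t).toAdd = l * (ε t).toAdd := by
      have := congrArg Multiplicative.toAdd hkl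
      simpa [toAdd_zpow] using this
    exact mul_right_cancel₀ (fun h0 => ht1 h0) h1
  choose k hk using hgen
  have hkmul : ∀ g h, k (g * h) = k g + k h := fun g h =>
    hinj _ _ (by rw [← hk, map_mul, zpow_add, ← hk, ← hk])
  -- projection of the image of `G` in `A` to that of the kernel, along the powers of `t`
  let B : Subgroup A := (χ.comp ε.ker.subtype).range
  let π₀ : G →* A :=
    { toFun := fun g => χ g * χ t ^ (-k g)
      map_one' := by
        have : k 1 = 0 := by simpa using hkmul 1 1
        simp [this]
      map_mul' := fun g h => by
        rw [hkmul, map_mul, neg_add, zpow_add]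
        exact mul_mul_mul_comm _ _ _ _ }
  have hπ₀ : ∀ g, π₀ g ∈ B := fun g => ⟨⟨g * t ^ (-k g), by
    simp [MonoidHom.mem_ker, ← hk]⟩, by simp [π₀]⟩
  let π : G →* B := π₀.codRestrict B hπ₀
  let κ : G →* Multiplicative (ZMod 2) :=
    { toFun := fun g => Multiplicative.ofAdd (k g : ZMod 2)
      map_one' := by
        have : k 1 = 0 := by simpa using hkmul 1 1
        simp [this]
      map_mul' := fun g h => by rw [hkmul, Int.cast_add, ofAdd_add] }
  have hkt : k t = 1 := hinj _ _ (by rw [← hk, zpow_one])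
  have hκt : κ t ≠ 1 := by
    change ((k t : ℤ) : ZMod 2) ≠ 0
    rw [hkt]; decide
  have htwo : ∀ a b : Multiplicative (ZMod 2), a ≠ 1 → b ≠ 1 → a * b = 1 := by decide
  have hκμ : κ μ ≠ 1 := fun h => hκt (by rw [hμ κ h, MonoidHom.one_apply])
  have hkp : ∀ p ∈ ε.ker, k p = 0 := fun p hp => hinj _ _ (by rw [← hk, zpow_zero]; exact hp)
  obtain ⟨n, hn, hn1⟩ := exists_pow_eq_one_of_forall_hom_zmod_two_trivial (B := B) (by
    intro f
    -- one of `f ∘ π` and `f ∘ π + κ` kills `μ`, and both restrict to `f` on the kernel of `ε`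
    have key : ∀ F : G →* Multiplicative (ZMod 2), F = 1 →
        (∀ p ∈ ε.ker, F p = f (π p)) → f = 1 := by
      rintro F rfl hF
      ext1 ⟨_, ⟨p, hp⟩, rfl⟩
      have e : π p = ⟨χ p, ⟨p, hp⟩, rfl⟩ := by
        apply Subtype.ext
        change χ p * χ t ^ (-k p) = χ p
        rw [hkp p hp]; simp
      exact (congrArg f e).symm.trans (hF p hp).symm
    by_cases hf : f (π μ) = 1
    · exact key (f.comp π) (hμ _ hf) (fun p _ => rfl)
    · refine key (f.comp π * κ) (hμ _ (htwo _ _ hf hκμ)) (fun p hp => ?_)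
      have : κ p = 1 := by
        change ((k p : ℤ) : ZMod 2) = 0
        rw [hkp p hp]; simp
      rw [MonoidHom.mul_apply, this, mul_one]
      rfl)
  exact ⟨n, hn, fun p hp => congrArg Subtype.val (hn1 ⟨χ p, ⟨p, hp⟩, rfl⟩)⟩

/-- Integrality of a non-commutative affine representation `z ↦ χ(g) z + τ(g)`: if the kernel `P`
of a homomorphism to `ℤ` is finitely generated and `χ` has finite exponent on `P`, then
`N = P ∩ ker χ` is finitely generated and contains the commutators, so `τ(N)` is a nonzero finitely
generated subgroup of `ℂ`, and it is stable under multiplication by `χ(g)`. -/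
theorem isIntegral_of_affine_not_commute {G : Type*} [Group G] (ε : G →* Multiplicative ℤ)
    [Group.FG ε.ker] (χ : G →* ℂˣ) (τ : G → ℂ) (hτ : ∀ g h, τ (g * h) = χ g * τ h + τ g)
    (n : ℕ) (hn : n ≠ 0) (hχn : ∀ p ∈ ε.ker, χ p ^ n = 1)
    (hne : ∃ g h, τ (g * h) ≠ τ (h * g)) (g : G) : IsIntegral ℤ (χ g : ℂ) := by
  let χP : ε.ker →* ℂˣ := χ.comp ε.ker.subtype
  have : Finite χP.range := by
    have : NeZero n := ⟨hn⟩
    have hle : χP.range ≤ rootsOfUnity n ℂ := by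
      rintro _ ⟨p, rfl⟩
      exact (mem_rootsOfUnity n _).mpr (hχn p p.2)
    exact Finite.of_injective _ (Subgroup.inclusion_injective hle)
  have : χP.ker.FiniteIndex := Subgroup.finiteIndex_ker χP
  have : Group.FG χP.ker := Subgroup.fg_of_index_ne_zero _
  have hτ1 : τ 1 = 0 := by simpa using hτ 1 1
  let T : χP.ker →* Multiplicative ℂ :=
    { toFun := fun p => Multiplicative.ofAdd (τ p.1.1)
      map_one' := by simp [hτ1]
      map_mul' := fun p q => by
        have hp : χ p.1.1 = 1 := p.2
        rw [← ofAdd_add]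
        congr 1
        change τ (p.1.1 * q.1.1) = _
        rw [hτ, hp, Units.val_one, one_mul, add_comm] }
  let L : Submodule ℤ ℂ := AddSubgroup.toIntSubmodule (Subgroup.toAddSubgroup' T.range)
  have hL : ∀ z : ℂ, z ∈ L ↔ ∃ p : G, ε p = 1 ∧ χ p = 1 ∧ τ p = z := by
    intro z
    constructor
    · rintro ⟨p, hp⟩
      exact ⟨p.1.1, p.1.2, p.2, hp⟩
    · rintro ⟨p, h1, h2, h3⟩
      exact ⟨⟨⟨p, h1⟩, h2⟩, h3⟩
  have hfg : L.FG := by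
    have h1 : Group.FG T.range := inferInstance
    rw [Group.fg_iff_subgroup_fg] at h1
    rw [Submodule.fg_iff_addSubgroup_fg]
    exact (Subgroup.fg_iff_add_fg _).mp h1
  have hcomm : ∀ g h : G, χ (g * h) = χ (h * g) := fun g h => by rw [map_mul, map_mul, mul_comm]
  have hbot : L ≠ ⊥ := by
    obtain ⟨g, h, hgh⟩ := hne
    intro hbot
    -- the commutator of `g` and `h` translates by an element of `L`
    have hc : τ (g * h * (h * g)⁻¹) ∈ L := (hL _).mpr ⟨_, by
      rw [map_mul, map_inv, map_mul, map_mul, mul_comm (ε h), mul_inv_cancel], by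
      rw [map_mul, map_inv, hcomm, mul_inv_cancel], rfl⟩
    rw [hbot, Submodule.mem_bot] at hc
    apply hgh
    have e : g * h = (g * h * (h * g)⁻¹) * (h * g) := by group
    have e1 : χ (g * h * (h * g)⁻¹) = 1 := by rw [map_mul, map_inv, hcomm, mul_inv_cancel]
    rw [e, hτ, hc, e1, Units.val_one, one_mul, add_zero]
  refine isIntegral_of_smul_mem_submodule L hbot hfg _ ?_
  intro z hz
  obtain ⟨p, h1, h2, rfl⟩ := (hL z).mp hz
  refine (hL _).mpr ⟨g * p * g⁻¹, by simp [h1], by simp [h2], ?_⟩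
  have h3 : τ (g * g⁻¹) = 0 := by rw [mul_inv_cancel, hτ1]
  rw [hτ] at h3
  rw [hτ, hτ, map_mul, h2, mul_one, smul_eq_mul]
  linear_combination h3

/-- The algebraic heart: a reducible non-abelian representation of `G` into `PSL(2, ℂ)` is integral
if `G` maps nontrivially to `ℤ` with finitely generated kernel, and if some `μ ∈ G` is killed by no
nontrivial homomorphism to `ℤ/2`. -/
theorem isIntegralRep_of_fg_ker {G : Type*} [Group G] (ε : G →* Multiplicative ℤ) (hε : ε ≠ 1)
    (hfg : Group.FG ε.ker) (μ : G)
    (hμ : ∀ f : G →* Multiplicative (ZMod 2), f μ = 1 → f = 1)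
    (ρ : G →* PSLTwoC) (hna : IsNonabelianRep ρ) (hred : IsReducibleRep ρ) :
    IsIntegralRep ρ := by
  obtain ⟨χ, τ, hτ, hinj, htr⟩ := exists_affine_of_isReducibleRep ρ hred
  obtain ⟨n, hn, hχn⟩ := exists_pow_eq_one_of_mem_ker ε hε μ hμ χ
  have hne : ∃ g h, τ (g * h) ≠ τ (h * g) := by
    obtain ⟨g, h, hgh⟩ := hna
    refine ⟨g, h, fun e => hgh ?_⟩
    rw [← map_mul, ← map_mul]
    exact hinj _ _ (by rw [map_mul, map_mul, mul_comm]) e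
  have hint := isIntegral_of_affine_not_commute ε χ τ hτ n hn hχn hne
  intro g A hA
  obtain ⟨a, ha, htr⟩ := htr g A hA
  rw [htr]
  refine IsIntegral.add (IsIntegral.of_pow two_pos (ha ▸ hint g))
    (IsIntegral.of_pow two_pos ?_)
  rw [inv_pow, ha, ← Units.val_inv_eq_inv_val, ← map_inv]
  exact hint g⁻¹

/-! ### Path cocycles -/

/-- A one-dimensional cohomology class of `X` with coefficients in the abelian group `A`, encoded by
its values on paths: a homotopy invariant function that is additive under concatenation (in other
words a functor from the fundamental groupoid to `A`). -/
structure PathCocycle (X : Type*) [TopologicalSpace X] (A : Type*) [AddCommGroup A] where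
  /-- the value of the class on a path -/
  val : ∀ {x y : X}, Path x y → A
  eq_of_homotopic : ∀ {x y : X} {p q : Path x y}, p.Homotopic q → val p = val q
  map_trans : ∀ {x y z : X} (p : Path x y) (q : Path y z), val (p.trans q) = val p + val q

namespace PathCocycle

variable {X Y A : Type*} [TopologicalSpace X] [TopologicalSpace Y] [AddCommGroup A]

/-- The value of a path cocycle depends only on the underlying function of the path. -/
theorem congr (c : PathCocycle X A) {x y x' y' : X} (p : Path x y) (q : Path x' y')
    (h : ∀ t, p t = q t) : c.val p = c.val q := by
  have hx : x = x' := by simpa using h 0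
  have hy : y = y' := by simpa using h 1
  subst hx hy
  rw [show p = q from Path.ext (funext h)]

theorem map_refl (c : PathCocycle X A) (x : X) : c.val (Path.refl x) = 0 := by
  have h := c.map_trans (Path.refl x) (Path.refl x)
  rw [Path.refl_trans_refl] at h
  simpa using h

theorem map_symm (c : PathCocycle X A) {x y : X} (p : Path x y) : c.val p.symm = -c.val p := by
  have h := c.eq_of_homotopic (Path.Homotopic.trans_symm p)
  rw [c.map_trans, c.map_refl] at h
  exact (neg_eq_of_add_eq_zero_right h).symm

theorem subpath_add (c : PathCocycle X A) {x y : X} (p : Path x y) (r s t : I) :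
    c.val (p.subpath r s) + c.val (p.subpath s t) = c.val (p.subpath r t) := by
  rw [← c.map_trans]
  exact c.eq_of_homotopic ⟨Path.Homotopy.subpathTransSubpath p r s t⟩

theorem subpath_zero_one (c : PathCocycle X A) {x y : X} (p : Path x y) :
    c.val (p.subpath 0 1) = c.val p :=
  c.congr _ _ fun t => by rw [Path.subpath_zero_one]; rfl

/-- The pullback of a path cocycle under a continuous map. -/
def comap (c : PathCocycle Y A) (f : C(X, Y)) : PathCocycle X A where
  val p := c.val (p.map f.continuous)
  eq_of_homotopic h := c.eq_of_homotopic (h.map f)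
  map_trans p q := by rw [Path.map_trans, c.map_trans]

theorem comap_val (c : PathCocycle Y A) (f : C(X, Y)) {x y : X} (p : Path x y) :
    (c.comap f).val p = c.val (p.map f.continuous) := rfl

/-- The difference of two path cocycles. -/
def sub (c d : PathCocycle X A) : PathCocycle X A where
  val p := c.val p - d.val p
  eq_of_homotopic h := by rw [c.eq_of_homotopic h, d.eq_of_homotopic h]
  map_trans p q := by rw [c.map_trans, d.map_trans]; abel

/-- A path cocycle on a path connected space that vanishes on the loops at one point is a
coboundary. -/
theorem exists_primitive [PathConnectedSpace X] (c : PathCocycle X A) (x₀ : X)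
    (h : ∀ p : Path x₀ x₀, c.val p = 0) :
    ∃ u : X → A, ∀ {x y : X} (p : Path x y), c.val p = u y - u x := by
  refine ⟨fun x => c.val (PathConnectedSpace.somePath x₀ x), fun {x y} p => ?_⟩
  have h1 := h (((PathConnectedSpace.somePath x₀ x).trans p).trans
    (PathConnectedSpace.somePath x₀ y).symm)
  rw [c.map_trans, c.map_trans, c.map_symm] at h1
  rw [eq_sub_iff_add_eq', ← sub_eq_zero, sub_eq_add_neg, h1]

/-- On a simply connected space every path cocycle is a coboundary. -/
theorem exists_primitive_of_simplyConnected [SimplyConnectedSpace X] (c : PathCocycle X A) :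
    ∃ u : X → A, ∀ {x y : X} (p : Path x y), c.val p = u y - u x := by
  obtain ⟨x₀⟩ := (inferInstance : Nonempty X)
  exact c.exists_primitive x₀ fun p => by
    rw [c.eq_of_homotopic (SimplyConnectedSpace.paths_homotopic p (Path.refl x₀)), c.map_refl]

/-- The homomorphism from the fundamental group given by a path cocycle. -/
def toHom (c : PathCocycle X A) (x : X) : FundamentalGroup X x →* Multiplicative A where
  toFun g := Quotient.lift (fun p : Path x x => Multiplicative.ofAdd (c.val p))
    (fun _ _ h => congrArg _ (c.eq_of_homotopic h)) g
  map_one' := congrArg Multiplicative.ofAdd (c.map_refl x)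
  map_mul' g h := by
    induction g using Quotient.inductionOn with | _ p
    induction h using Quotient.inductionOn with | _ q
    exact congrArg Multiplicative.ofAdd ((c.map_trans q p).trans (add_comm _ _))

/-- On a path connected space every homomorphism from the fundamental group to an abelian group
is given by a path cocycle. -/
theorem exists_toHom_eq [PathConnectedSpace X] (x₀ : X)
    (φ : FundamentalGroup X x₀ →* Multiplicative A) : ∃ c : PathCocycle X A, c.toHom x₀ = φ := by
  let τ : ∀ x, Path.Homotopic.Quotient x₀ x := fun x => .mk (PathConnectedSpace.somePath x₀ x)
  -- close up a path by the chosen paths from the base point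
  let cl : ∀ {x y : X}, Path x y → FundamentalGroup X x₀ := fun {x y} p =>
    ((τ x).trans (.mk p)).trans (τ y).symm
  let c : PathCocycle X A :=
    { val := fun p => (φ (cl p)).toAdd
      eq_of_homotopic := fun {x y p q} h => by
        have : (Path.Homotopic.Quotient.mk p) = .mk q := Path.Homotopic.Quotient.eq.mpr h
        simp only [cl, this]
      map_trans := fun {x y z} p q => by
        rw [← toAdd_mul, mul_comm, ← map_mul]
        congr 2
        simp only [cl, FundamentalGroup.mul_def]
        simp only [Path.Homotopic.Quotient.mk_trans, Path.Homotopic.Quotient.trans_assoc]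
        congr 2
        rw [← Path.Homotopic.Quotient.trans_assoc (τ y).symm,
          Path.Homotopic.Quotient.symm_trans, Path.Homotopic.Quotient.refl_trans] }
  refine ⟨c, ?_⟩
  ext1 g
  induction g using Quotient.inductionOn with | _ p
  let t : FundamentalGroup X x₀ := τ x₀
  have h1 : cl p = t⁻¹ * (FundamentalGroup.fromPath (.mk p) * t) := rfl
  change Multiplicative.ofAdd (φ (cl p)).toAdd = φ (FundamentalGroup.fromPath (.mk p))
  rw [ofAdd_toAdd, h1, map_mul, map_mul, map_inv, mul_comm (φ _) (φ t), inv_mul_cancel_left]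

end PathCocycle

/-! ### The winding number -/

/-- Every path in the circle has a continuous choice of angles. -/
theorem exists_angle {x y : Circle} (p : Path x y) : ∃ s : C(I, ℝ), ∀ t, Circle.exp (s t) = p t := by
  obtain ⟨e, he⟩ := Circle.exp_surjective x
  obtain ⟨s, hs, -⟩ := Circle.isCoveringMap_exp.exists_path_lifts p.toContinuousMap e (by simp [he])
  exact ⟨s, congrFun hs⟩

/-- The change of angle does not depend on the choice of angles, and only on the homotopy class. -/
theorem angle_sub_eq_of_homotopic {x y : Circle} {p q : Path x y} (h : p.Homotopic q)
    (s s' : C(I, ℝ)) (hs : ∀ t, Circle.exp (s t) = p t) (hs' : ∀ t, Circle.exp (s' t) = q t) :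
    s 1 - s 0 = s' 1 - s' 0 := by
  have cov := Circle.isCoveringMap_exp
  have e0 : Circle.exp (s 0) = Circle.exp (s' 0) := by simp [hs, hs']
  -- translate `s'` by a multiple of `2π` so that both choices start at the same angle
  let s'' : C(I, ℝ) := ⟨fun t => s' t + (s 0 - s' 0), by fun_prop⟩
  have hs'' : ∀ t, Circle.exp (s'' t) = q t := fun t => by
    change Circle.exp (s' t + (s 0 - s' 0)) = q t
    rw [Circle.exp_add, Circle.exp_sub, e0, div_self', mul_one, hs']
  have h0 : p.toContinuousMap 0 = Circle.exp (s 0) := (hs 0).symm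
  have h0' : q.toContinuousMap 0 = Circle.exp (s 0) := by rw [e0]; exact (hs' 0).symm
  have h1 := cov.liftPath_apply_one_eq_of_homotopicRel h (s 0) h0 h0'
  have l1 : s = cov.liftPath p.toContinuousMap (s 0) h0 :=
    (cov.eq_liftPath_iff' _).mpr ⟨funext hs, rfl⟩
  have l2 : s'' = cov.liftPath q.toContinuousMap (s 0) h0' :=
    (cov.eq_liftPath_iff' _).mpr ⟨funext hs'', by simp [s'']⟩
  rw [← l1, ← l2] at h1
  rw [h1]
  change s' 1 + (s 0 - s' 0) - s 0 = s' 1 - s' 0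
  ring

/-- The winding number of a path in the circle (the total change of its angle) as a path cocycle. -/
noncomputable def windingCocycle : PathCocycle Circle ℝ where
  val p := (exists_angle p).choose 1 - (exists_angle p).choose 0
  eq_of_homotopic h := angle_sub_eq_of_homotopic h _ _ (exists_angle _).choose_spec
    (exists_angle _).choose_spec
  map_trans {x y z} p q := by
    obtain ⟨s, hs⟩ := exists_angle (p.trans q)
    -- the two halves of a choice of angles for the concatenation
    have c1 : Continuous fun t : I => s (Set.projIcc 0 1 zero_le_one ((t : ℝ) / 2)) := by
      exact s.continuous.comp (continuous_projIcc.comp (by fun_prop))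
    have c2 : Continuous fun t : I => s (Set.projIcc 0 1 zero_le_one (((t : ℝ) + 1) / 2)) := by
      exact s.continuous.comp (continuous_projIcc.comp (by fun_prop))
    have h1 : ∀ t, Circle.exp ((⟨_, c1⟩ : C(I, ℝ)) t) = p t := fun t => by
      change Circle.exp (s _) = p t
      have ht := t.2
      rw [hs, Path.trans_apply, dif_pos]
      · congr 1
        ext
        simp only [Set.coe_projIcc]
        rw [min_eq_right (by linarith [ht.2]), max_eq_right (by linarith [ht.1])]
        ring
      · simp only [Set.coe_projIcc]
        rw [min_eq_right (by linarith [ht.2]), max_eq_right (by linarith [ht.1])]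
        linarith [ht.2]
    have h2 : ∀ t, Circle.exp ((⟨_, c2⟩ : C(I, ℝ)) t) = q t := fun t => by
      change Circle.exp (s _) = q t
      have ht := t.2
      have e : Set.projIcc 0 1 zero_le_one (((t : ℝ) + 1) / 2)
          = σ ⟨(1 - t) / 2, by constructor <;> linarith [ht.1, ht.2]⟩ := by
        ext
        simp only [Set.coe_projIcc, unitInterval.coe_symm_eq]
        rw [min_eq_right (by linarith [ht.2]), max_eq_right (by linarith [ht.1])]
        ring
      have e' : ∀ u, (p.trans q) (σ u) = (q.symm.trans p.symm) u := fun u => by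
        rw [← Path.trans_symm]; rfl
      rw [hs, e, e', Path.trans_apply, dif_pos]
      · change q (σ _) = q t
        congr 1
        ext
        simp only [unitInterval.coe_symm_eq]
        ring
      · change (1 - (t : ℝ)) / 2 ≤ 1 / 2
        linarith [ht.1]
    rw [angle_sub_eq_of_homotopic (.refl p) _ _ (exists_angle p).choose_spec h1,
      angle_sub_eq_of_homotopic (.refl q) _ _ (exists_angle q).choose_spec h2,
      angle_sub_eq_of_homotopic (.refl (p.trans q)) _ _ (exists_angle _).choose_spec hs]
    have v0 : Set.projIcc (0 : ℝ) 1 zero_le_one (((0 : I) : ℝ) / 2) = 0 := by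
      ext; simp
    have v1 : Set.projIcc (0 : ℝ) 1 zero_le_one ((((1 : I) : ℝ) + 1) / 2) = 1 := by
      ext; norm_num [Set.coe_projIcc]
    have v2 : Set.projIcc (0 : ℝ) 1 zero_le_one ((((0 : I) : ℝ) + 1) / 2)
        = Set.projIcc (0 : ℝ) 1 zero_le_one (((1 : I) : ℝ) / 2) := by
      simp
    simp only [ContinuousMap.coe_mk, v0, v1, v2]
    ring

/-- The winding number can be computed from any continuous choice of angles. -/
theorem windingCocycle_eq {x y : Circle} (p : Path x y) (s : C(I, ℝ))
    (hs : ∀ t, Circle.exp (s t) = p t) : windingCocycle.val p = s 1 - s 0 :=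
  angle_sub_eq_of_homotopic (.refl p) _ _ (exists_angle p).choose_spec hs

/-- Loops in the circle have winding numbers in `2πℤ`. -/
theorem exists_int_windingCocycle_eq {x : Circle} (p : Path x x) :
    ∃ n : ℤ, windingCocycle.val p = n * (2 * Real.pi) := by
  obtain ⟨s, hs⟩ := exists_angle p
  rw [windingCocycle_eq p s hs]
  obtain ⟨n, hn⟩ := Circle.exp_eq_exp.mp (show Circle.exp (s 1) = Circle.exp (s 0) by simp [hs])
  exact ⟨n, by rw [hn]; ring⟩

/-- The fundamental group of the circle is cyclic. -/
theorem isCyclic_fundamentalGroup_circle (x : Circle) : IsCyclic (FundamentalGroup Circle x) := by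
  obtain ⟨e, he⟩ := Circle.exp_surjective x
  let i := Circle.isAddQuotientCoveringMap_exp.fundamentalGroupEquiv (⟨e, he⟩ : Circle.exp ⁻¹' {x})
  have : IsCyclic (Multiplicative (AddSubgroup.zmultiples (2 * Real.pi)))ᵐᵒᵖ :=
    isCyclic_of_surjective (MulEquiv.inv' (Multiplicative (AddSubgroup.zmultiples (2 * Real.pi))))
      (MulEquiv.surjective _)
  exact isCyclic_of_surjective i.symm i.symm.surjective

/-! ### Finite generation of the fundamental group -/

/-- Short subpaths stay in a given open set. -/
theorem Path.eventually_subpath_mem {X : Type*} [TopologicalSpace X] {x y : X} (γ : Path x y)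
    (t : I) {U : Set X} (hU : IsOpen U) (ht : γ t ∈ U) :
    ∀ᶠ s in 𝓝 t, ∀ r, γ.subpath t s r ∈ U := by
  have key : ∀ᶠ s in 𝓝 t, ∀ r ∈ (Set.univ : Set I), γ.subpath t s r ∈ U := by
    refine isCompact_univ.eventually_forall_of_forall_eventually fun r _ => ?_
    have hc : Continuous fun z : I × I => γ.subpath t z.1 z.2 := by
      change Continuous fun z : I × I => γ (Set.Icc.convexComb t z.1 z.2)
      exact γ.continuous.comp (Set.Icc.continuous_convexComb_prod.comp
        (f := fun z : I × I => (t, z.1, z.2)) (by fun_prop))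
    refine hc.continuousAt.eventually_mem (hU.mem_nhds ?_)
    simpa using ht
  filter_upwards [key] with s hs r using hs r trivial

/-- A property of points of `[0, 1]` that is locally constant spreads from `0` to `1`. -/
theorem unitInterval.of_eventually_iff {Q : I → Prop} (h : ∀ t, ∀ᶠ s in 𝓝 t, (Q s ↔ Q t))
    (h0 : Q 0) (t : I) : Q t := by
  have : IsLocallyConstant Q := (IsLocallyConstant.iff_eventually_eq Q).mpr fun t => by
    filter_upwards [h t] with s hs using propext hs
  exact this.apply_eq_of_preconnectedSpace 0 t ▸ h0

/-- Two paths with the same ends in a simply connected subset are homotopic. -/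
theorem IsSimplyConnected.homotopic_of_mem {X : Type*} [TopologicalSpace X] {O : Set X}
    (hO : IsSimplyConnected O) {x y : X} (p q : Path x y) (hp : ∀ t, p t ∈ O)
    (hq : ∀ t, q t ∈ O) : p.Homotopic q := by
  have : SimplyConnectedSpace O := hO
  have hx : x ∈ O := by simpa using hp 0
  have hy : y ∈ O := by simpa using hp 1
  let p' : Path (⟨x, hx⟩ : O) ⟨y, hy⟩ :=
    { toFun := fun t => ⟨p t, hp t⟩, source' := by simp, target' := by simp }
  let q' : Path (⟨x, hx⟩ : O) ⟨y, hy⟩ :=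
    { toFun := fun t => ⟨q t, hq t⟩, source' := by simp, target' := by simp }
  exact (SimplyConnectedSpace.paths_homotopic p' q').map ⟨Subtype.val, continuous_subtype_val⟩

/-- The simply connected open sets form a basis of the topology. -/
def HasSimplyConnectedBasis (X : Type*) [TopologicalSpace X] : Prop :=
  ∀ (x : X), ∀ O ∈ 𝓝 x, ∃ U : Set X, IsOpen U ∧ x ∈ U ∧ U ⊆ O ∧ IsSimplyConnected U

theorem HasSimplyConnectedBasis.locallyPathConnectedSpace {X : Type*} [TopologicalSpace X]
    (hX : HasSimplyConnectedBasis X) : LocallyPathConnectedSpace X :=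
  .of_bases (p := fun x U => IsOpen U ∧ x ∈ U ∧ IsSimplyConnected U) (s := fun _ U => U)
    (fun x => ⟨fun O => ⟨fun hO => by
      obtain ⟨U, h1, h2, h3, h4⟩ := hX x O hO
      exact ⟨U, ⟨h1, h2, h4⟩, h3⟩, fun ⟨U, ⟨h1, h2, _⟩, h3⟩ =>
        Filter.mem_of_superset (h1.mem_nhds h2) h3⟩⟩)
    fun _ _ h => h.2.2.isPathConnected

/-- The classes of the loops `δ i · q · (δ j)⁻¹` based at `x₀`, where `q` runs through the paths
from `i` to `j` in `D`. -/
def loopClassesThrough {X : Type*} [TopologicalSpace X] {x₀ : X} (δ : ∀ i, Joined x₀ i → Path x₀ i)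
    (i j : X) (D : Set X) : Set (FundamentalGroup X x₀) :=
  {g | ∃ (hi : Joined x₀ i) (hj : Joined x₀ j) (q : Path i j), (∀ t, q t ∈ D) ∧
    g = FundamentalGroup.fromPath (.mk (((δ i hi).trans q).trans (δ j hj).symm))}

theorem subsingleton_loopClassesThrough {X : Type*} [TopologicalSpace X] {x₀ : X}
    (δ : ∀ i, Joined x₀ i → Path x₀ i) (i j : X) {D O : Set X} (hO : IsSimplyConnected O)
    (hD : D ⊆ O) : (loopClassesThrough δ i j D).Subsingleton := by
  rintro _ ⟨hi, hj, q, hq, rfl⟩ _ ⟨_, _, q', hq', rfl⟩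
  refine Path.Homotopic.Quotient.eq.mpr ?_
  exact ((Path.Homotopic.refl _).hcomp (hO.homotopic_of_mem q q' (fun t => hD (hq t))
    (fun t => hD (hq' t)))).hcomp (.refl _)

/-- The fundamental group of a compact Hausdorff space that has a basis of simply connected open
sets is finitely generated. Take a finite cover by simply connected open sets such that the union
of any two members meeting a third one, together with it, lies in a simply connected set. Connect
the base point to the members of the cover. Closing up the paths inside members of the cover gives
finitely many classes, and these generate. -/
theorem fundamentalGroup_fg_of_compactSpace {X : Type*} [TopologicalSpace X] [CompactSpace X]
    [T2Space X] (hX : HasSimplyConnectedBasis X) (x₀ : X) : Group.FG (FundamentalGroup X x₀) := by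
  classical
  let _ : UniformSpace X := uniformSpaceOfCompactR1
  choose O hOo hxO _ hOs using fun x : X => hX x Set.univ Filter.univ_mem
  obtain ⟨V, hV, hVO⟩ := lebesgue_number_lemma (isCompact_univ (X := X)) hOo
    (fun x _ => Set.mem_iUnion.mpr ⟨x, hxO x⟩)
  obtain ⟨E, hE, hEsymm, hEV⟩ := comp_comp_symm_mem_uniformity_sets hV
  choose U hUo hxU hUE hUs using fun x : X => hX x _ (UniformSpace.ball_mem_nhds x hE)
  obtain ⟨s, hs⟩ := isCompact_univ.elim_finite_subcover U hUo
    (fun x _ => Set.mem_iUnion.mpr ⟨x, hxU x⟩)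
  have hidx : ∀ y, ∃ i ∈ s, y ∈ U i := fun y => by
    have := hs (Set.mem_univ y)
    simp only [Set.mem_iUnion] at this
    obtain ⟨i, hi, hy⟩ := this
    exact ⟨i, hi, hy⟩
  choose idx hidxs hidxU using hidx
  have hstar : ∀ k, ∃ o, ∀ i, (U i ∩ U k).Nonempty → U i ⊆ O o := by
    intro k
    obtain ⟨o, ho⟩ := hVO k trivial
    refine ⟨o, fun i ⟨a, hai, hak⟩ z hz => ho (hEV ?_)⟩
    exact ⟨i, ⟨a, hUE k hak, hEsymm.symm _ _ (hUE i hai)⟩, hUE i hz⟩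
  let δ : ∀ i, Joined x₀ i → Path x₀ i := fun i h => h.somePath
  choose ζ hζ using fun y => (hUs (idx y)).isPathConnected.joinedIn _ (hxU _) _ (hidxU y)
  let S : X × X × X → Set (FundamentalGroup X x₀) := fun ikj =>
    {g | (U ikj.1 ∩ U ikj.2.1).Nonempty ∧ (U ikj.2.2 ∩ U ikj.2.1).Nonempty ∧
      g ∈ loopClassesThrough δ ikj.1 ikj.2.2 (U ikj.1 ∪ U ikj.2.1 ∪ U ikj.2.2)}
  have hSfin : (⋃ ikj ∈ s ×ˢ s ×ˢ s, S ikj).Finite := by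
    refine (Finset.finite_toSet _).biUnion fun ⟨i, k, j⟩ _ => Set.Subsingleton.finite ?_
    rintro g ⟨h1, h2, hg⟩ g' ⟨_, _, hg'⟩
    obtain ⟨o, ho⟩ := hstar k
    refine subsingleton_loopClassesThrough δ i j (hOs o) ?_ hg hg'
    exact Set.union_subset (Set.union_subset (ho i h1) (ho k ⟨k, hxU k, hxU k⟩)) (ho j h2)
  let H := Subgroup.closure (⋃ ikj ∈ s ×ˢ s ×ˢ s, S ikj)
  -- close up a path to a loop at the base point
  have hJ : ∀ {y}, Joined x₀ y → Joined x₀ (idx y) := fun h => h.trans ⟨(ζ _).symm⟩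
  let τ : ∀ y, Joined x₀ y → Path x₀ y := fun y h => (δ (idx y) (hJ h)).trans (ζ y)
  let cl : ∀ {a b} (_ : Joined x₀ a) (_ : Joined x₀ b), Path a b → FundamentalGroup X x₀ :=
    fun {a b} ha hb p => FundamentalGroup.fromPath (.mk (((τ a ha).trans p).trans (τ b hb).symm))
  have hcl_trans : ∀ {a b d} (ha : Joined x₀ a) (hb : Joined x₀ b) (hd : Joined x₀ d)
      (p : Path a b) (q : Path b d), cl ha hd (p.trans q) = cl hb hd q * cl ha hb p := by
    intro a b d ha hb hd p q
    simp only [cl, FundamentalGroup.mul_def, Path.Homotopic.Quotient.mk_trans,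
      Path.Homotopic.Quotient.trans_assoc, Path.Homotopic.Quotient.mk_symm]
    congr 2
    rw [← Path.Homotopic.Quotient.trans_assoc ((Path.Homotopic.Quotient.mk (τ b hb)).symm),
      Path.Homotopic.Quotient.symm_trans, Path.Homotopic.Quotient.refl_trans]
  have hcl_homotopic : ∀ {a b} (ha : Joined x₀ a) (hb : Joined x₀ b) (p q : Path a b),
      p.Homotopic q → cl ha hb p = cl ha hb q := by
    intro a b ha hb p q h
    exact Path.Homotopic.Quotient.eq.mpr (((Path.Homotopic.refl _).hcomp h).hcomp (.refl _))
  have hcl_cast : ∀ {a b a' b'} (ha : Joined x₀ a) (hb : Joined x₀ b) (ha' : Joined x₀ a')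
      (hb' : Joined x₀ b') (e : a' = a) (e' : b' = b) (p : Path a b),
      cl ha' hb' (p.cast e e') = cl ha hb p := by
    rintro a b _ _ ha hb ha' hb' rfl rfl p
    rfl
  have hsmall : ∀ {a b} (ha : Joined x₀ a) (hb : Joined x₀ b) (p : Path a b) (k : X), k ∈ s →
      (∀ t, p t ∈ U k) → cl ha hb p ∈ H := by
    intro a b ha hb p k hk hp
    apply Subgroup.subset_closure
    refine Set.mem_biUnion (x := (idx a, k, idx b))
      (by simp [hidxs, hk]) ⟨⟨a, hidxU a, ?_⟩, ⟨b, hidxU b, ?_⟩, hJ ha, hJ hb,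
        ((ζ a).trans p).trans (ζ b).symm, ?_, ?_⟩
    · simpa using hp 0
    · simpa using hp 1
    · intro t
      have ht : (((ζ a).trans p).trans (ζ b).symm) t
          ∈ Set.range (((ζ a).trans p).trans (ζ b).symm) := ⟨t, rfl⟩
      rw [Path.trans_range, Path.trans_range, Path.symm_range] at ht
      rcases ht with (⟨r, hr⟩ | ⟨r, hr⟩) | ⟨r, hr⟩ <;> rw [← hr]
      · exact Or.inl (Or.inl (hζ a r))
      · exact Or.inl (Or.inr (hp r))
      · exact Or.inr (hζ b r)
    · simp only [cl, τ, Path.Homotopic.Quotient.mk_trans, Path.Homotopic.Quotient.trans_assoc,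
        Path.trans_symm]
  have hall : ∀ {a b} (ha : Joined x₀ a) (hb : Joined x₀ b) (p : Path a b), cl ha hb p ∈ H := by
    intro a b ha hb p
    have hJp : ∀ t, Joined x₀ (p t) := fun t =>
      ha.trans ⟨(p.subpath 0 t).cast p.source.symm rfl⟩
    have hQ : ∀ t, cl (hJp 0) (hJp t) (p.subpath 0 t) ∈ H := by
      refine unitInterval.of_eventually_iff (fun t => ?_) ?_
      · filter_upwards [p.eventually_subpath_mem t (hUo (idx (p t))) (hidxU (p t))] with r hr
        have e : cl (hJp 0) (hJp r) (p.subpath 0 r)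
            = cl (hJp t) (hJp r) (p.subpath t r) * cl (hJp 0) (hJp t) (p.subpath 0 t) := by
          rw [← hcl_trans (hJp 0) (hJp t) (hJp r)]
          exact hcl_homotopic (hJp 0) (hJp r) _ _
            (Path.Homotopic.symm ⟨Path.Homotopy.subpathTransSubpath p 0 t r⟩)
        rw [e]
        exact Subgroup.mul_mem_cancel_left _ (hsmall (hJp t) (hJp r) _ _ (hidxs _) hr)
      · refine hsmall (hJp 0) (hJp 0) _ _ (hidxs (p 0)) fun t => ?_
        rw [Path.subpath_self]
        exact hidxU (p 0)
    have h1 := hQ 1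
    rw [Path.subpath_zero_one, hcl_cast ha hb (hJp 0) (hJp 1)] at h1
    exact h1
  have hJ0 : Joined x₀ x₀ := Joined.refl x₀
  let t₀ : FundamentalGroup X x₀ := FundamentalGroup.fromPath (.mk (τ x₀ hJ0))
  rw [Group.fg_iff]
  refine ⟨_, ?_, hSfin⟩
  rw [eq_top_iff]
  intro g _
  -- closing up at the base point is an inner automorphism
  obtain ⟨p, hp⟩ : ∃ p : Path x₀ x₀, FundamentalGroup.fromPath (.mk p) = t₀ * g * t₀⁻¹ :=
    Path.Homotopic.Quotient.mk_surjective _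
  have h1 : cl hJ0 hJ0 p = t₀⁻¹ * (FundamentalGroup.fromPath (.mk p) * t₀) := rfl
  have h2 : cl hJ0 hJ0 p = g := by
    rw [h1, hp]; group
  exact h2 ▸ hall hJ0 hJ0 p

/-! ### Simply connected neighbourhoods in manifolds -/

/-- A space that embeds into a normed space with convex image has a basis of simply connected open
sets: the traces of balls. -/
theorem HasSimplyConnectedBasis.of_isEmbedding_of_convex {H E : Type*} [TopologicalSpace H]
    [NormedAddCommGroup E] [NormedSpace ℝ E] {f : H → E} (hf : IsEmbedding f)
    (hconv : Convex ℝ (Set.range f)) : HasSimplyConnectedBasis H := by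
  intro x O hO
  rw [hf.nhds_eq_comap, (Metric.nhds_basis_ball.comap f).mem_iff] at hO
  obtain ⟨r, hr, hrO⟩ := hO
  refine ⟨f ⁻¹' Metric.ball (f x) r, Metric.isOpen_ball.preimage hf.continuous,
    Metric.mem_ball_self hr, hrO, ?_⟩
  rw [← hf.isSimplyConnected_image, Set.image_preimage_eq_inter_range]
  have : ContractibleSpace (Metric.ball (f x) r ∩ Set.range f : Set E) :=
    ((convex_ball _ _).inter hconv).contractibleSpace ⟨f x, Metric.mem_ball_self hr, x, rfl⟩
  exact (inferInstance : SimplyConnectedSpace (Metric.ball (f x) r ∩ Set.range f : Set E))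

theorem HasSimplyConnectedBasis.of_chartedSpace {H M : Type*} [TopologicalSpace H]
    [TopologicalSpace M] [ChartedSpace H M] (hH : HasSimplyConnectedBasis H) :
    HasSimplyConnectedBasis M := by
  intro x O hO
  let e := chartAt H x
  have hx : x ∈ e.source := mem_chart_source H x
  have hO' : e.symm ⁻¹' O ∩ e.target ∈ 𝓝 (e x) :=
    Filter.inter_mem ((e.continuousAt_symm (e.map_source hx)).preimage_mem_nhds
      (by rwa [e.left_inv hx])) (e.open_target.mem_nhds (e.map_source hx))
  obtain ⟨U, hU, hxU, hUO, hUs⟩ := hH _ _ hO'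
  have hUt : U ⊆ e.symm.source := fun z hz => (hUO hz).2
  refine ⟨e.symm '' U, e.symm.isOpen_image_of_subset_source hU hUt,
    ⟨e x, hxU, e.left_inv hx⟩, ?_, ?_⟩
  · rintro _ ⟨z, hz, rfl⟩
    exact (hUO hz).1
  · have := hUs.simplyConnectedSpace
    exact (e.symm.homeomorphOfImageSubsetSource hUt rfl).symm.toHomotopyEquiv.simplyConnectedSpace

theorem hasSimplyConnectedBasis_euclideanSpace (n : ℕ) :
    HasSimplyConnectedBasis (EuclideanSpace ℝ (Fin n)) :=
  .of_isEmbedding_of_convex .id (by rw [Set.range_id]; exact convex_univ)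

theorem hasSimplyConnectedBasis_euclideanHalfSpace (n : ℕ) [NeZero n] :
    HasSimplyConnectedBasis (EuclideanHalfSpace n) := by
  refine .of_isEmbedding_of_convex (f := Subtype.val) .subtypeVal ?_
  have hrange : Set.range (Subtype.val : EuclideanHalfSpace n → EuclideanSpace ℝ (Fin n))
      = {x | 0 ≤ x 0} := Subtype.range_val
  rw [hrange]
  intro x hx y hy a b ha hb _
  change 0 ≤ a * x 0 + b * y 0
  exact add_nonneg (mul_nonneg ha hx) (mul_nonneg hb hy)

/-- In a compact locally path connected space two members of any sequence can be joined. -/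
theorem exists_ne_joined_of_compactSpace {X : Type*} [TopologicalSpace X] [CompactSpace X]
    [LocallyPathConnectedSpace X] (y : ℕ → X) : ∃ j k, j ≠ k ∧ Joined (y j) (y k) := by
  obtain ⟨j, k, hjk, h⟩ :=
    Finite.exists_ne_map_eq_of_infinite fun n => ZerothHomotopy.mk (y n)
  exact ⟨j, k, hjk, Quotient.exact h⟩

/-! ### Bundles over the circle -/

section CircleBundle

variable {M F : Type*} [TopologicalSpace M] [TopologicalSpace F] {p : M → Circle}

/-- The fiber over `s` of the pullback of `p : M → S¹` along the universal covering `ℝ → S¹`. -/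
def ExpPullback (p : M → Circle) (s : ℝ) : Type _ := {m : M // p m = Circle.exp s}

instance (s : ℝ) : TopologicalSpace (ExpPullback p s) :=
  inferInstanceAs (TopologicalSpace {m : M // p m = Circle.exp s})

/-- The total space of the pullback is topologized as a subspace of `ℝ × M`. -/
instance : TopologicalSpace (Bundle.TotalSpace F (ExpPullback p)) :=
  .induced (fun z => (z.1, z.2.1)) (inferInstanceAs (TopologicalSpace (ℝ × M)))

omit [TopologicalSpace F] in
theorem isInducing_totalSpace_expPullback :
    IsInducing fun z : Bundle.TotalSpace F (ExpPullback p) => ((z.1, z.2.1) : ℝ × M) := ⟨rfl⟩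

open Classical in
/-- The inverse of the pullback of a trivialization of `p : M → S¹` along the universal covering of
the circle. The point `x₀` only serves to define it everywhere. -/
noncomputable def Bundle.Trivialization.expPullbackInv (x₀ : M) (e : Bundle.Trivialization F p)
    (q : ℝ × F) : Bundle.TotalSpace F (ExpPullback p) :=
  if h : Circle.exp q.1 ∈ e.baseSet then
    ⟨q.1, e.toOpenPartialHomeomorph.symm (Circle.exp q.1, q.2), e.proj_symm_apply' h⟩
  else ⟨Complex.arg (p x₀), x₀, (Circle.exp_arg (p x₀)).symm⟩

theorem Bundle.Trivialization.expPullbackInv_of_mem (x₀ : M) (e : Bundle.Trivialization F p)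
    (q : ℝ × F) (h : Circle.exp q.1 ∈ e.baseSet) : e.expPullbackInv x₀ q =
      ⟨q.1, e.toOpenPartialHomeomorph.symm (Circle.exp q.1, q.2), e.proj_symm_apply' h⟩ :=
  dif_pos h

/-- The pullback of a trivialization of `p : M → S¹` along the universal covering of the circle. -/
noncomputable def Bundle.Trivialization.expPullback (x₀ : M) (e : Bundle.Trivialization F p) :
    Bundle.Trivialization F (Bundle.TotalSpace.proj : Bundle.TotalSpace F (ExpPullback p) → ℝ) where
  toFun z := (z.1, (e z.2.1).2)
  invFun := e.expPullbackInv x₀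
  source := {z | Circle.exp z.1 ∈ e.baseSet}
  target := {q | Circle.exp q.1 ∈ e.baseSet}
  map_source' z hz := hz
  map_target' q hq := by
    rw [e.expPullbackInv_of_mem x₀ q hq]
    exact hq
  left_inv' := by
    rintro ⟨s, m, hm⟩ hz
    have hz' : Circle.exp s ∈ e.baseSet := hz
    rw [e.expPullbackInv_of_mem x₀ _ hz']
    congr 2
    change e.toOpenPartialHomeomorph.symm (Circle.exp s, (e m).2) = m
    rw [← hm]
    exact e.symm_apply_mk_proj (e.mem_source.mpr (hm ▸ hz))
  right_inv' := by
    intro q hq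
    rw [e.expPullbackInv_of_mem x₀ q hq]
    change (q.1, (e (e.toOpenPartialHomeomorph.symm (Circle.exp q.1, q.2))).2) = q
    rw [e.apply_symm_apply' hq]
  open_source := by
    refine e.open_baseSet.preimage (Circle.exp.continuous.comp ?_)
    exact continuous_fst.comp isInducing_totalSpace_expPullback.continuous
  open_target := e.open_baseSet.preimage (Circle.exp.continuous.comp continuous_fst)
  continuousOn_toFun := by
    have h1 := (isInducing_totalSpace_expPullback (F := F) (p := p)).continuous
    refine (continuous_fst.comp h1).continuousOn.prodMk
      (continuous_snd.comp_continuousOn (e.continuousOn_toFun.comp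
        (continuous_snd.comp h1).continuousOn ?_))
    rintro ⟨s, m, hm⟩ hz
    have hz' : Circle.exp s ∈ e.baseSet := hz
    exact e.mem_source.mpr (show p m ∈ e.baseSet by rwa [hm])
  continuousOn_invFun := by
    rw [isInducing_totalSpace_expPullback.continuousOn_iff]
    have hc : ContinuousOn (fun q : ℝ × F =>
        ((q.1, e.toOpenPartialHomeomorph.symm (Circle.exp q.1, q.2)) : ℝ × M))
        {q | Circle.exp q.1 ∈ e.baseSet} := by
      refine continuousOn_fst.prodMk (e.continuousOn_invFun.comp (by fun_prop) ?_)
      intro q hq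
      exact e.mem_target.mpr hq
    refine hc.congr fun q hq => ?_
    rw [Function.comp_apply, e.expPullbackInv_of_mem x₀ q hq]
  baseSet := {s | Circle.exp s ∈ e.baseSet}
  open_baseSet := e.open_baseSet.preimage Circle.exp.continuous
  source_eq := rfl
  target_eq := by ext; simp
  proj_toFun z hz := rfl

/-- The pullback of a locally trivial bundle along the universal covering of the circle. -/
@[reducible] noncomputable def expPullbackFiberBundle (x₀ : M)
    (hloc : ∀ b : Circle, ∃ e : Bundle.Trivialization F p, b ∈ e.baseSet) :
    FiberBundle F (ExpPullback p) where
  totalSpaceMk_isInducing' s := by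
    rw [← isInducing_totalSpace_expPullback.of_comp_iff]
    exact isInducing_const_prod.mpr (IsInducing.subtypeVal (t := {m : M | p m = Circle.exp s}))
  trivializationAtlas' := Set.range (Bundle.Trivialization.expPullback x₀)
  trivializationAt' s := (hloc (Circle.exp s)).choose.expPullback x₀
  mem_baseSet_trivializationAt' s := (hloc (Circle.exp s)).choose_spec
  trivialization_mem_atlas' s := ⟨_, rfl⟩

/-- Over each bounded interval the pullback of a bundle over the circle is a product: there are
fiber coordinates `Φ`, with inverse `Ψ`. -/
theorem exists_trivialization_expPullback (x₀ : M)
    (hloc : ∀ b : Circle, ∃ e : Bundle.Trivialization F p, b ∈ e.baseSet) (a b : ℝ) :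
    ∃ (Ψ : F × ℝ → M) (Φ : M × ℝ → F),
      ContinuousOn Ψ {q | q.2 ∈ Set.Icc a b} ∧
      ContinuousOn Φ {q | q.2 ∈ Set.Icc a b ∧ p q.1 = Circle.exp q.2} ∧
      (∀ f, ∀ s ∈ Set.Icc a b, p (Ψ (f, s)) = Circle.exp s) ∧
      (∀ f, ∀ s ∈ Set.Icc a b, Φ (Ψ (f, s), s) = f) ∧
      ∀ m, ∀ s ∈ Set.Icc a b, p m = Circle.exp s → Ψ (Φ (m, s), s) = m := by
  classical
  let _ := expPullbackFiberBundle x₀ hloc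
  obtain ⟨e, he⟩ := FiberBundle.exists_trivialization_Icc_subset F (ExpPullback p) a b
  let f₀ : F := ((hloc (p x₀)).choose x₀).2
  let Ψ : F × ℝ → M := fun q => (e.toOpenPartialHomeomorph.symm (q.2, q.1)).2.1
  let Φ : M × ℝ → F := fun q => if h : p q.1 = Circle.exp q.2 then (e ⟨q.2, q.1, h⟩).2 else f₀
  have hproj : ∀ f, ∀ s ∈ Set.Icc a b, (e.toOpenPartialHomeomorph.symm (s, f)).1 = s :=
    fun f s hs => e.proj_symm_apply' (he hs)
  have hΨp : ∀ f, ∀ s ∈ Set.Icc a b, p (Ψ (f, s)) = Circle.exp s := fun f s hs => by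
    exact (e.toOpenPartialHomeomorph.symm (s, f)).2.2.trans (congrArg _ (hproj f s hs))
  have hval : Continuous fun z : Bundle.TotalSpace F (ExpPullback p) => z.2.1 :=
    continuous_snd.comp isInducing_totalSpace_expPullback.continuous
  have hmk : ∀ f s (hs : s ∈ Set.Icc a b),
      (⟨s, Ψ (f, s), hΨp f s hs⟩ : Bundle.TotalSpace F (ExpPullback p))
        = e.toOpenPartialHomeomorph.symm (s, f) := fun f s hs => by
    have h1 := hproj f s hs
    have h2 : Ψ (f, s) = (e.toOpenPartialHomeomorph.symm (s, f)).2.1 := rfl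
    revert h2
    generalize_proofs h3
    revert h3
    generalize Ψ (f, s) = m
    revert h1
    generalize e.toOpenPartialHomeomorph.symm (s, f) = z
    obtain ⟨s', m', hm'⟩ := z
    rintro rfl h3 rfl
    rfl
  refine ⟨Ψ, Φ, ?_, ?_, hΨp, ?_, ?_⟩
  · refine hval.comp_continuousOn (e.continuousOn_invFun.comp (by fun_prop) ?_)
    intro q hq
    exact e.mem_target.mpr (he hq)
  · rw [continuousOn_iff_continuous_domRestrict]
    have h1 : Continuous fun q : {q : M × ℝ | q.2 ∈ Set.Icc a b ∧ p q.1 = Circle.exp q.2} =>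
        (⟨q.1.2, q.1.1, q.2.2⟩ : Bundle.TotalSpace F (ExpPullback p)) := by
      rw [isInducing_totalSpace_expPullback.continuous_iff]
      change Continuous fun q : {q : M × ℝ | q.2 ∈ Set.Icc a b ∧ p q.1 = Circle.exp q.2} =>
        ((q.1.2, q.1.1) : ℝ × M)
      fun_prop
    have h2 : Continuous fun q : {q : M × ℝ | q.2 ∈ Set.Icc a b ∧ p q.1 = Circle.exp q.2} =>
        (e (⟨q.1.2, q.1.1, q.2.2⟩ : Bundle.TotalSpace F (ExpPullback p))).2 :=
      continuous_snd.comp (e.continuousOn.comp_continuous h1 fun q => e.mem_source.mpr (he q.2.1))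
    refine h2.congr fun q => ?_
    simp only [Set.domRestrict_apply, Φ, dif_pos q.2.2]
  · intro f s hs
    simp only [Φ, dif_pos (hΨp f s hs)]
    rw [hmk f s hs, e.apply_symm_apply' (he hs)]
  · intro m s hs hm
    simp only [Φ, dif_pos hm, Ψ]
    have := e.symm_apply_mk_proj (x := ⟨s, m, hm⟩) (e.mem_source.mpr (he hs))
    exact congrArg (fun z : Bundle.TotalSpace F (ExpPullback p) => z.2.1) this

/-- A path in the total space along which the angle returns to its initial value can be deformed,
with fixed ends, into a fiber. -/
theorem exists_homotopic_path_in_fiber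
    (hloc : ∀ b : Circle, ∃ e : Bundle.Trivialization F p, b ∈ e.baseSet) {x y : M} (γ : Path x y)
    (s : C(I, ℝ)) (hs : ∀ t, Circle.exp (s t) = p (γ t)) (h01 : s 0 = s 1) :
    ∃ q : Path x y, γ.Homotopic q ∧ ∀ t, p (q t) = Circle.exp (s 0) := by
  obtain ⟨a, ha⟩ := (isCompact_range s.continuous).bddBelow
  obtain ⟨b, hb⟩ := (isCompact_range s.continuous).bddAbove
  have hab : ∀ t, s t ∈ Set.Icc a b := fun t => ⟨ha ⟨t, rfl⟩, hb ⟨t, rfl⟩⟩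
  obtain ⟨Ψ, Φ, hΨ, hΦ, hΨp, -, hΨΦ⟩ := exists_trivialization_expPullback x hloc a b
  have hf : Continuous fun t => Φ (γ t, s t) :=
    hΦ.comp_continuous (by fun_prop) fun t => ⟨hab t, (hs t).symm⟩
  -- move the angle linearly to its initial value, keeping the fiber coordinate
  have hmem : ∀ z : I × I, (1 - (z.1 : ℝ)) * s z.2 + z.1 * s 0 ∈ Set.Icc a b := fun z =>
    convex_Icc a b (hab z.2) (hab 0) (sub_nonneg.mpr z.1.2.2) z.1.2.1 (by ring)
  have hH : Continuous fun z : I × I =>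
      Ψ (Φ (γ z.2, s z.2), (1 - (z.1 : ℝ)) * s z.2 + z.1 * s 0) :=
    hΨ.comp_continuous ((hf.comp continuous_snd).prodMk (by fun_prop)) hmem
  have h0 : Ψ (Φ (x, s 0), s 0) = x :=
    hΨΦ x _ (hab 0) (by rw [hs, γ.source])
  have h1 : Ψ (Φ (y, s 0), s 0) = y :=
    hΨΦ y _ (hab 0) (by rw [h01, hs, γ.target])
  let q : Path x y :=
    { toFun := fun t => Ψ (Φ (γ t, s t), s 0)
      continuous_toFun := hΨ.comp_continuous (hf.prodMk continuous_const) fun t => hab 0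
      source' := by rw [γ.source, h0]
      target' := by rw [γ.target, ← h01, h1] }
  refine ⟨q, ⟨⟨⟨⟨_, hH⟩, ?_, ?_⟩, ?_⟩⟩, fun t => hΨp _ _ (hab 0)⟩
  · intro t
    simpa using hΨΦ (γ t) _ (hab t) (hs t).symm
  · intro t
    simp [q]
  · intro u t ht
    rcases ht with rfl | rfl
    · change Ψ (Φ (γ 0, s 0), (1 - (u : ℝ)) * s 0 + u * s 0) = γ 0
      rw [show (1 - (u : ℝ)) * s 0 + u * s 0 = s 0 by ring, γ.source, h0]
    · change Ψ (Φ (γ 1, s 1), (1 - (u : ℝ)) * s 1 + u * s 0) = γ 1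
      rw [← h01, show (1 - (u : ℝ)) * s 0 + u * s 0 = s 0 by ring, γ.target, h1]

/-- For a bundle over the circle with compact Hausdorff fiber that has a basis of simply connected
open sets, the fundamental group of the total space has a nontrivial homomorphism to `ℤ` with
finitely generated kernel: the winding number of the projection. The kernel is the image of the fundamental group of a fiber. The homomorphism is
nontrivial because the points reached by lifting the multiples of the standard loop cannot all lie
in different components of the fiber. -/
theorem exists_hom_int_fg_ker [CompactSpace F] [T2Space F] (hF : HasSimplyConnectedBasis F)
    (hloc : ∀ b : Circle, ∃ e : Bundle.Trivialization F p, b ∈ e.baseSet) (x : M) :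
    ∃ ε : FundamentalGroup M x →* Multiplicative ℤ, ε ≠ 1 ∧ Group.FG ε.ker := by
  have hp : Continuous p := continuous_iff_continuousAt.mpr fun m => by
    obtain ⟨e, he⟩ := hloc (p m)
    exact e.continuousAt_proj (e.mem_source.mpr he)
  let w : PathCocycle M ℝ := windingCocycle.comap ⟨p, hp⟩
  have hw : ∀ {y z : M} (γ : Path y z) (s : C(I, ℝ)), (∀ t, Circle.exp (s t) = p (γ t)) →
      w.val γ = s 1 - s 0 := fun γ s hs => windingCocycle_eq _ s hs
  have hint : ∀ g : FundamentalGroup M x, ∃ n : ℤ, (w.toHom x g).toAdd = n * (2 * Real.pi) := by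
    intro g
    obtain ⟨γ, rfl⟩ := Path.Homotopic.Quotient.mk_surjective g
    exact exists_int_windingCocycle_eq _
  choose n hn using hint
  have hinj : ∀ k l : ℤ, (k : ℝ) * (2 * Real.pi) = l * (2 * Real.pi) → k = l := fun k l h =>
    Int.cast_injective (mul_right_cancel₀ Real.two_pi_pos.ne' h)
  let ε : FundamentalGroup M x →* Multiplicative ℤ :=
    { toFun := fun g => Multiplicative.ofAdd (n g)
      map_one' := by
        rw [ofAdd_eq_one]
        exact hinj _ _ (by rw [← hn, map_one]; simp)
      map_mul' := fun g h => by
        rw [← ofAdd_add]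
        congr 1
        exact hinj _ _ (by rw [← hn, map_mul, toAdd_mul, hn, hn]; push_cast; ring) }
  have hε : ∀ γ : Path x x, ε (.mk γ) = 1 ↔ w.val γ = 0 := by
    intro γ
    have h1 : w.val γ = n (.mk γ) * (2 * Real.pi) := hn (.mk γ)
    rw [h1]
    change n (.mk γ) = 0 ↔ _
    simp [Real.pi_ne_zero]
  obtain ⟨c, hc⟩ := Circle.exp_surjective (p x)
  -- coordinates on the fiber through `x`
  obtain ⟨Ψ, Φ, hΨ, hΦ, hΨp, hΦΨ, hΨΦ⟩ := exists_trivialization_expPullback x hloc c c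
  have hcc : c ∈ Set.Icc c c := ⟨le_rfl, le_rfl⟩
  have hj : Continuous fun f => Ψ (f, c) := hΨ.comp_continuous (by fun_prop) fun _ => hcc
  refine ⟨ε, ?_, ?_⟩
  · have hlift : ∀ k : ℕ, ∃ (y : M) (δ : Path x y), p y = Circle.exp c ∧
        w.val δ = k * (2 * Real.pi) := by
      intro k
      obtain ⟨Ψ', Φ', hΨ', -, hΨp', -, hΨΦ'⟩ :=
        exists_trivialization_expPullback x hloc c (c + k * (2 * Real.pi))
      have hk : 0 ≤ k * (2 * Real.pi) := by positivity
      let s : C(I, ℝ) := ⟨fun t => c + t * (k * (2 * Real.pi)), by fun_prop⟩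
      have hs : ∀ t, s t ∈ Set.Icc c (c + k * (2 * Real.pi)) := fun t =>
        ⟨le_add_of_nonneg_right (mul_nonneg t.2.1 hk),
          add_le_add_right (mul_le_of_le_one_left hk t.2.2) c⟩
      have hs0 : s 0 = c := by simp [s]
      have hs1 : s 1 = c + k * (2 * Real.pi) := by simp [s]
      let δ : Path x (Ψ' (Φ' (x, c), s 1)) :=
        { toFun := fun t => Ψ' (Φ' (x, c), s t)
          continuous_toFun := hΨ'.comp_continuous (by fun_prop) hs
          source' := by
            rw [hs0]
            exact hΨΦ' x c (hs0 ▸ hs 0) hc.symm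
          target' := rfl }
      refine ⟨_, δ, ?_, ?_⟩
      · rw [hΨp' _ _ (hs 1), hs1, Circle.exp_add]
        have := Circle.exp_int_mul_two_pi k
        rw [Int.cast_natCast] at this
        rw [this, mul_one]
      · rw [hw δ s fun t => (hΨp' _ _ (hs t)).symm, hs0, hs1]
        ring
    choose y δ hy hδ using hlift
    have := hF.locallyPathConnectedSpace
    obtain ⟨j, k, hjk, ⟨κ⟩⟩ := exists_ne_joined_of_compactSpace fun k => Φ (y k, c)
    have hyΨ : ∀ k, y k = Ψ (Φ (y k, c), c) := fun k => (hΨΦ _ c hcc (hy k)).symm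
    let κ' : Path (y j) (y k) := (κ.map hj).cast (hyΨ j) (hyΨ k)
    have hκ' : w.val κ' = 0 := by
      rw [hw κ' (.const I c) fun t => (hΨp _ c hcc).symm]
      simp
    intro h1
    have h2 := (hε (((δ j).trans κ').trans (δ k).symm)).mp (by rw [h1]; rfl)
    rw [w.map_trans, w.map_trans, w.map_symm, hκ', hδ, hδ, add_zero, ← sub_eq_add_neg,
      sub_eq_zero] at h2
    exact hjk (by exact_mod_cast mul_right_cancel₀ Real.two_pi_pos.ne' h2)
  · have hx : Ψ (Φ (x, c), c) = x := hΨΦ x c hcc hc.symm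
    have hfg := fundamentalGroup_fg_of_compactSpace hF (Φ (x, c))
    let i : FundamentalGroup F (Φ (x, c)) →* FundamentalGroup M x :=
      FundamentalGroup.mapOfEq ⟨_, hj⟩ hx
    have hi : ∀ q : Path (Φ (x, c)) (Φ (x, c)),
        i (.mk q) = Path.Homotopic.Quotient.mk ((q.map hj).cast hx.symm hx.symm) := fun q =>
      FundamentalGroup.mapOfEq_apply _ _ _
    have hker : ε.ker = i.range := by
      ext g
      constructor
      · intro hg
        obtain ⟨γ, rfl⟩ := Path.Homotopic.Quotient.mk_surjective g
        have hγ : w.val γ = 0 := (hε γ).mp hg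
        obtain ⟨s, hs⟩ := exists_angle (γ.map hp)
        rw [hw γ s hs, sub_eq_zero] at hγ
        obtain ⟨q, hγq, hq⟩ := exists_homotopic_path_in_fiber hloc γ s hs hγ.symm
        have hqc : ∀ t, p (q t) = Circle.exp c := fun t => by
          rw [hq, hs, hc]
          simp
        let r : Path (Φ (x, c)) (Φ (x, c)) :=
          { toFun := fun t => Φ (q t, c)
            continuous_toFun := hΦ.comp_continuous (by fun_prop) fun t => ⟨hcc, hqc t⟩
            source' := by simp
            target' := by simp }
        refine ⟨.mk r, (hi r).trans (Path.Homotopic.Quotient.eq.mpr ?_)⟩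
        have e : (r.map hj).cast hx.symm hx.symm = q := by
          ext t
          exact hΨΦ _ c hcc (hqc t)
        rw [e]
        exact hγq.symm
      · rintro ⟨g', rfl⟩
        obtain ⟨q, rfl⟩ := Path.Homotopic.Quotient.mk_surjective g'
        rw [hi, MonoidHom.mem_ker]
        refine (hε _).mpr ?_
        rw [hw ((q.map hj).cast hx.symm hx.symm) (.const I c) fun t => (hΨp (q t) c hcc).symm]
        simp
    rw [hker]
    infer_instance

end CircleBundle

/-! ### Classes given by local potentials -/

/-- A one-dimensional cohomology class of `X` with coefficients in `A`, given by potentials: a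
function `u i` on each member `baseSet i` of an open cover (extended arbitrarily to `X`), such that
the differences of two potentials are locally constant where both are defined. -/
structure LocalPotentials (X : Type*) [TopologicalSpace X] (A : Type*) [AddCommGroup A]
    (ι : Type*) where
  /-- the members of the cover -/
  baseSet : ι → Set X
  /-- the potentials -/
  u : ι → X → A
  isOpen_baseSet : ∀ i, IsOpen (baseSet i)
  exists_mem_baseSet : ∀ x, ∃ i, x ∈ baseSet i
  eventually_sub_eq : ∀ i j, ∀ x ∈ baseSet i, x ∈ baseSet j →
    ∀ᶠ y in 𝓝 x, u i y - u j y = u i x - u j x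

namespace LocalPotentials

variable {X A ι : Type*} [TopologicalSpace X] [AddCommGroup A] (L : LocalPotentials X A ι)

/-- `H` is a primitive along `g : T → X` of the class given by the potentials: it differs from each
of the pulled back potentials by a locally constant function. -/
def IsPrimitive {T : Type*} [TopologicalSpace T] (g : T → X) (H : T → A) : Prop :=
  ∀ i t, g t ∈ L.baseSet i → ∀ᶠ s in 𝓝 t, H s - L.u i (g s) = H t - L.u i (g t)

variable {L} in
theorem IsPrimitive.comp {S T : Type*} [TopologicalSpace S] [TopologicalSpace T] {g : T → X}
    {H : T → A} (h : L.IsPrimitive g H) {f : S → T} (hf : Continuous f) :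
    L.IsPrimitive (g ∘ f) (H ∘ f) :=
  fun i s hs => hf.continuousAt.eventually (h i (f s) hs)

variable {L} in
/-- Over a connected space, two primitives differ by a constant. -/
theorem IsPrimitive.sub_eq_sub {T : Type*} [TopologicalSpace T] [PreconnectedSpace T] {g : T → X}
    {H H' : T → A} (h : L.IsPrimitive g H) (h' : L.IsPrimitive g H') (s t : T) :
    H s - H t = H' s - H' t := by
  have : IsLocallyConstant fun t => H t - H' t := (IsLocallyConstant.iff_eventually_eq _).mpr
    fun t => by
      obtain ⟨i, hi⟩ := L.exists_mem_baseSet (g t)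
      filter_upwards [h i t hi, h' i t hi] with s hs hs'
      rw [← sub_sub_sub_cancel_right _ _ (L.u i (g s)), hs, hs', sub_sub_sub_cancel_right]
  have h1 := this.apply_eq_of_preconnectedSpace s t
  rw [sub_eq_sub_iff_sub_eq_sub]
  exact h1

/-- The covering space of `X` whose sections are the primitives, as a fiber bundle with the discrete
fiber `A`. A point over `x` is a possible value at `x` of a primitive; its `i`-th coordinate is
obtained by subtracting `u i x`. -/
noncomputable def primitiveCore [TopologicalSpace A] [DiscreteTopology A] :
    FiberBundleCore ι X A where
  baseSet := L.baseSet
  isOpen_baseSet := L.isOpen_baseSet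
  indexAt x := (L.exists_mem_baseSet x).choose
  mem_baseSet_at x := (L.exists_mem_baseSet x).choose_spec
  coordChange i j x a := a + (L.u i x - L.u j x)
  coordChange_self i x _ a := by simp
  continuousOn_coordChange i j := by
    rintro ⟨x, a⟩ ⟨⟨hi, hj⟩, -⟩
    have h1 : ∀ᶠ q : X × A in 𝓝 (x, a),
        q.2 + (L.u i x - L.u j x) = q.2 + (L.u i q.1 - L.u j q.1) := by
      filter_upwards [continuousAt_fst.eventually (L.eventually_sub_eq i j x hi hj)] with q hq
      rw [hq]
    have h2 : Continuous fun q : X × A => q.2 + (L.u i x - L.u j x) :=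
      (continuous_of_discreteTopology (f := fun a : A => a + (L.u i x - L.u j x))).comp
        continuous_snd
    exact (h2.continuousAt.congr h1).continuousWithinAt
  coordChange_comp i j k x _ a := by abel

/-- Over a simply connected space the class has a primitive: lift to the covering space. -/
theorem exists_isPrimitive {T : Type*} [TopologicalSpace T] [SimplyConnectedSpace T]
    [LocallyPathConnectedSpace T] (g : C(T, X)) : ∃ H : T → A, L.IsPrimitive g H := by
  let _ : TopologicalSpace A := ⊥
  have : DiscreteTopology A := ⟨rfl⟩
  let Z := L.primitiveCore
  have cov : IsCoveringMap Z.proj := FiberBundle.isCoveringMap (F := A) (E := Z.Fiber)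
  obtain ⟨t₀⟩ := (inferInstance : Nonempty T)
  obtain ⟨G, ⟨-, hG⟩, -⟩ := cov.existsUnique_continuousMap_lifts g t₀ ⟨g t₀, (0 : A)⟩ rfl
  have hG1 : ∀ t, (G t).1 = g t := congrFun hG
  let val : Z.TotalSpace → A := fun z => (show A from z.2) + L.u (Z.indexAt z.1) z.1
  refine ⟨fun t => val (G t), fun i t hi => ?_⟩
  have hcoord : ∀ s, (Z.localTriv i (G s)).2 = val (G s) - L.u i (g s) := fun s => by
    rw [Z.localTriv_apply, ← hG1]
    change (show A from (G s).2) + (L.u _ _ - L.u i _) = _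
    simp only [val]
    abel
  have hc : ContinuousAt (fun s => (Z.localTriv i (G s)).2) t := by
    refine continuous_snd.continuousAt.comp (ContinuousAt.comp (f := G) ?_ G.continuous.continuousAt)
    refine (Z.localTriv i).continuousAt ?_
    rw [Z.mem_localTriv_source, hG1]
    exact hi
  have hev : ∀ᶠ s in 𝓝 t, (Z.localTriv i (G s)).2 = (Z.localTriv i (G t)).2 := by
    have := hc.tendsto
    rw [nhds_discrete A, Filter.tendsto_pure] at this
    exact this
  filter_upwards [hev] with s hs
  rw [← hcoord, ← hcoord, hs]

end LocalPotentials

/-! ### Singular homology with coefficients in `ℤ/2` -/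

section SingularHomology

universe v

open CategoryTheory Simplicial

/-- If `H₁(S; R) = 0`, then a one-cocycle of the simplicial set `S` with values in `R` vanishes on the
one-simplices that are loops: such a simplex is a cycle, hence a boundary. -/
theorem SSet.cocycle_eq_zero_of_loop {R : Type u} [CommRing R] (S : SSet.{v})
    (hS : Subsingleton ((S.chainComplex (ModuleCat.of R (ULift.{v} R))).homology 1))
    (φ : S _⦋1⦌ → R) (hφ : ∀ y : S _⦋2⦌, φ (S.δ 0 y) - φ (S.δ 1 y) + φ (S.δ 2 y) = 0)
    (x : S _⦋1⦌) (hx : S.δ 0 x = S.δ 1 x) : φ x = 0 := by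
  let K := S.chainComplex (ModuleCat.of R (ULift.{v} R))
  have hK : K.ExactAt 1 := by
    rw [HomologicalComplex.exactAt_iff_isZero_homology]
    exact @ModuleCat.isZero_of_subsingleton _ _ _ hS
  rw [K.exactAt_iff' 2 1 0 (by simp) (by simp), ShortComplex.moduleCat_exact_iff] at hK
  -- the cocycle as a linear form on the one-chains
  let F : K.X 1 ⟶ ModuleCat.of R (ULift.{v} R) :=
    Limits.Cofan.IsColimit.desc (S.isColimitChainComplexXCofan _ 1) fun z => φ z • 𝟙 _
  have hF : ∀ z, S.ιChainComplex z ≫ F = φ z • 𝟙 _ := fun z =>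
    Limits.Cofan.IsColimit.fac (S.isColimitChainComplexXCofan _ 1) _ z
  have hdF : K.d 2 1 ≫ F = 0 := by
    refine SSet.chainComplex_hom_ext fun y => ?_
    have h2 : S.ιChainComplex y ≫ K.d 2 1 ≫ F
        = (∑ i : Fin 3, (-1) ^ i.val • S.ιChainComplex (S.δ i y)) ≫ F := by
      rw [← Category.assoc, SSet.ιChainComplex_d]
    rw [h2, Preadditive.sum_comp, Fin.sum_univ_three, Limits.comp_zero]
    simp only [Preadditive.zsmul_comp, hF]
    have h1 := congrArg (fun a : R => a • 𝟙 (ModuleCat.of R (ULift.{v} R))) (hφ y)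
    simp only [add_smul, sub_smul, zero_smul] at h1
    simpa [sub_eq_add_neg] using h1
  have hd : S.ιChainComplex (R := ModuleCat.of R (ULift.{v} R)) x ≫ K.d 1 0 = 0 := by
    rw [SSet.ιChainComplex_d, Fin.sum_univ_two, hx]
    simp
  obtain ⟨z, hz⟩ := hK (S.ιChainComplex (R := ModuleCat.of R (ULift.{v} R)) x ⟨1⟩)
    (ConcreteCategory.congr_hom hd _)
  have h1 : F (S.ιChainComplex (R := ModuleCat.of R (ULift.{v} R)) x ⟨1⟩) = 0 :=
    (congrArg F hz).symm.trans (ConcreteCategory.congr_hom hdF z)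
  have h2 : (φ x • 𝟙 (ModuleCat.of R (ULift.{v} R)) : _ ⟶ _) ⟨1⟩ = 0 :=
    (ConcreteCategory.congr_hom (hF x) _).symm.trans h1
  have h3 : (φ x • (⟨1⟩ : ULift.{v} R)).down = 0 := congrArg ULift.down h2
  simpa using h3

/-- The `i`-th vertex of the topological `n`-simplex. -/
noncomputable def topSimplexVertex (n : ℕ) (i : Fin (n + 1)) : SimplexCategory.toTop.{u}.obj ⦋n⦌ :=
  SimplexCategory.toTop.map (SimplexCategory.const ⦋0⦌ ⦋n⦌ i) default

theorem toTop_map_topSimplexVertex {m n : ℕ} (f : (⦋m⦌ : SimplexCategory) ⟶ ⦋n⦌) (i : Fin (m + 1)) :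
    SimplexCategory.toTop.{u}.map f (topSimplexVertex m i) = topSimplexVertex n (f i) := by
  unfold topSimplexVertex
  rw [← ConcreteCategory.comp_apply, ← Functor.map_comp, SimplexCategory.const_comp]
  rfl

theorem down_topSimplexVertex (n : ℕ) (i : Fin (n + 1)) :
    (topSimplexVertex.{u} n i).down = (stdSimplex.vertex i : stdSimplex ℝ (Fin (n + 1))) := by
  have h : (default : SimplexCategory.toTop.{u}.obj ⦋0⦌)
      = ULift.up (stdSimplex.vertex 0 : stdSimplex ℝ (Fin 1)) := Subsingleton.elim _ _
  unfold topSimplexVertex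
  rw [h]
  exact stdSimplex.map_vertex _ _

theorem simplyConnectedSpace_topSimplex (n : ℕ) :
    SimplyConnectedSpace (SimplexCategory.toTop.{u}.obj ⦋n⦌) := by
  have : ContractibleSpace (stdSimplex ℝ (Fin (n + 1))) :=
    (convex_stdSimplex ℝ _).contractibleSpace ⟨_, single_mem_stdSimplex ℝ 0⟩
  exact (Homeomorph.ulift (X := stdSimplex ℝ (Fin (n + 1)))).toHomotopyEquiv.simplyConnectedSpace

theorem locallyPathConnectedSpace_topSimplex (n : ℕ) :
    LocallyPathConnectedSpace (SimplexCategory.toTop.{u}.obj ⦋n⦌) := by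
  refine (HasSimplyConnectedBasis.of_isEmbedding_of_convex (H := SimplexCategory.toTop.{u}.obj ⦋n⦌)
    (E := Fin (n + 1) → ℝ) (f := fun z => z.down.1) ?_ ?_).locallyPathConnectedSpace
  · exact IsEmbedding.subtypeVal.comp
      (Homeomorph.ulift (X := stdSimplex ℝ (Fin (n + 1)))).isEmbedding
  · have h : Set.range (fun z : SimplexCategory.toTop.{u}.obj ⦋n⦌ => z.down.1)
        = stdSimplex ℝ (Fin (n + 1)) := by
      ext z
      constructor
      · rintro ⟨y, rfl⟩
        exact y.down.2
      · exact fun hz => ⟨⟨⟨z, hz⟩⟩, rfl⟩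
    rw [h]
    exact convex_stdSimplex ℝ _

/-- If `H₁(X; ℤ/2) = 0`, then the primitives along loops of a class given by local potentials in
`ℤ/2` close up: the change of a primitive along singular one-simplices is a singular cocycle. -/
theorem LocalPotentials.IsPrimitive.apply_zero_eq_apply_one {X : Type u} [TopologicalSpace X]
    (hX : Subsingleton (HomologyModTwo 1 X)) {ι : Type*} {L : LocalPotentials X (ZMod 2) ι}
    {g : C(I, X)} (hg : g 0 = g 1) {H : I → ZMod 2} (hH : L.IsPrimitive g H) : H 0 = H 1 := by
  have hsc := simplyConnectedSpace_topSimplex.{u}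
  have hlpc := locallyPathConnectedSpace_topSimplex.{u}
  set S := TopCat.toSSet.obj (TopCat.of X) with hS
  let toMap (n : ℕ) (x : S _⦋n⦌) : C(SimplexCategory.toTop.{u}.obj ⦋n⦌, X) :=
    TopCat.Hom.hom x.down
  choose P hP using fun x : S _⦋1⦌ => L.exists_isPrimitive (toMap 1 x)
  let φ : S _⦋1⦌ → ZMod 2 := fun x => P x (topSimplexVertex 1 1) - P x (topSimplexVertex 1 0)
  have hφ : ∀ (x : S _⦋1⦌) (Q), L.IsPrimitive (toMap 1 x) Q →
      φ x = Q (topSimplexVertex 1 1) - Q (topSimplexVertex 1 0) := fun x Q hQ =>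
    (hP x).sub_eq_sub hQ _ _
  have hcocycle : ∀ y : S _⦋2⦌, φ (S.δ 0 y) - φ (S.δ 1 y) + φ (S.δ 2 y) = 0 := by
    intro y
    obtain ⟨Q, hQ⟩ := L.exists_isPrimitive (toMap 2 y)
    have hface : ∀ i, φ (S.δ i y)
        = Q (topSimplexVertex 2 (SimplexCategory.δ i 1))
          - Q (topSimplexVertex 2 (SimplexCategory.δ i 0)) := by
      intro i
      rw [hφ _ _ (hQ.comp (TopCat.Hom.hom (SimplexCategory.toTop.{u}.map
        (SimplexCategory.δ i))).continuous)]
      have := toTop_map_topSimplexVertex.{u} (SimplexCategory.δ (n := 1) i)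
      simp only [Function.comp_apply]
      rw [← this, ← this]
    rw [hface, hface, hface]
    have d00 : (SimplexCategory.δ (n := 1) 0) 0 = 1 := rfl
    have d01 : (SimplexCategory.δ (n := 1) 0) 1 = 2 := rfl
    have d10 : (SimplexCategory.δ (n := 1) 1) 0 = 0 := rfl
    have d11 : (SimplexCategory.δ (n := 1) 1) 1 = 2 := rfl
    have d20 : (SimplexCategory.δ (n := 1) 2) 0 = 0 := rfl
    have d21 : (SimplexCategory.δ (n := 1) 2) 1 = 1 := rfl
    rw [d00, d01, d10, d11, d20, d21]
    abel
  -- the loop as a singular simplex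
  let r : C(SimplexCategory.toTop.{u}.obj ⦋1⦌, I) :=
    ⟨fun z => stdSimplexHomeomorphUnitInterval z.down,
      stdSimplexHomeomorphUnitInterval.continuous.comp continuous_uliftDown⟩
  let x : S _⦋1⦌ := ULift.up (TopCat.ofHom (g.comp r))
  have hr0 : r (topSimplexVertex.{u} 1 0) = 0 :=
    congrArg stdSimplexHomeomorphUnitInterval (down_topSimplexVertex.{u} 1 0)
  have hr1 : r (topSimplexVertex.{u} 1 1) = 1 :=
    congrArg stdSimplexHomeomorphUnitInterval (down_topSimplexVertex.{u} 1 1)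
  have hx : S.δ 0 x = S.δ 1 x := by
    have hface : ∀ i z, toMap 0 (S.δ i x) z
        = g (r (topSimplexVertex 1 (SimplexCategory.δ i 0))) := by
      intro i z
      rw [Subsingleton.elim z (topSimplexVertex 0 0), ← toTop_map_topSimplexVertex]
      rfl
    have h : toMap 0 (S.δ 0 x) = toMap 0 (S.δ 1 x) := by
      ext z
      rw [hface, hface]
      exact (congrArg g hr1).trans (hg.symm.trans (congrArg g hr0.symm))
    exact congrArg (fun f => ULift.up (TopCat.ofHom f)) h
  have h := hφ x (H ∘ r) (hH.comp r.continuous)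
  rw [SSet.cocycle_eq_zero_of_loop S hX φ hcocycle x hx] at h
  simp only [Function.comp_apply, hr0, hr1] at h
  exact (sub_eq_zero.mp h.symm).symm

end SingularHomology

/-! ### Gluing path cocycles -/

/-- A path, seen as a path in a subset containing it. -/
def Path.codRestrict {X : Type*} [TopologicalSpace X] {x y : X} (p : Path x y) {O : Set X}
    (h : ∀ t, p t ∈ O) : Path (⟨x, p.source ▸ h 0⟩ : O) ⟨y, p.target ▸ h 1⟩ where
  toFun t := ⟨p t, h t⟩
  source' := Subtype.ext p.source
  target' := Subtype.ext p.target

namespace PathCocycle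

section Gluing

variable {X A : Type*} [TopologicalSpace X] [AddCommGroup A]

/-- The sum of a path cocycle and the coboundary of a function. -/
def addCoboundary (c : PathCocycle X A) (h : X → A) : PathCocycle X A where
  val {x y} p := c.val p + (h y - h x)
  eq_of_homotopic hpq := by rw [c.eq_of_homotopic hpq]
  map_trans p q := by rw [c.map_trans]; abel

/-- The function `u` is a potential on `U` of the path cocycle `c`, which is defined on `O`. -/
def IsPotentialOn {O : Set X} (c : PathCocycle O A) (U : Set X) (u : X → A) : Prop :=
  U ⊆ O ∧ ∀ {x y : O} (p : Path x y), (∀ t, (p t : X) ∈ U) → c.val p = u y - u x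

theorem exists_isPotentialOn (hX : HasSimplyConnectedBasis X) {O : Set X} (hO : IsOpen O)
    (c : PathCocycle O A) {x : X} (hx : x ∈ O) :
    ∃ (U : Set X) (u : X → A), IsOpen U ∧ x ∈ U ∧ c.IsPotentialOn U u := by
  classical
  obtain ⟨U, hU, hxU, hUO, hsc⟩ := hX x O (hO.mem_nhds hx)
  have : SimplyConnectedSpace U := hsc
  obtain ⟨u, hu⟩ := (c.comap ⟨Set.inclusion hUO, continuous_inclusion hUO⟩
    ).exists_primitive_of_simplyConnected
  refine ⟨U, fun y => if h : y ∈ U then u ⟨y, h⟩ else 0, hU, hxU, hUO, fun {y z} p hp => ?_⟩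
  have hy : (y : X) ∈ U := by simpa using hp 0
  have hz : (z : X) ∈ U := by simpa using hp 1
  simp only [dif_pos hy, dif_pos hz]
  rw [← hu ((p.map continuous_subtype_val).codRestrict (O := U) hp), comap_val]
  exact c.congr _ _ fun t => rfl

/-- If `H₁(X; ℤ/2) = 0`, then path cocycles on the members of an open cover of `X` that agree on the
overlaps vanish on loops. The potentials of the cocycles give a class of `X`, of which the cocycle
itself is a primitive along each loop. -/
theorem eq_zero_of_agree {X : Type u} [TopologicalSpace X] (hX : HasSimplyConnectedBasis X)
    (hH : Subsingleton (HomologyModTwo 1 X)) {κ : Type*} {O : κ → Set X} (hO : ∀ k, IsOpen (O k))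
    (hcover : ∀ x, ∃ k, x ∈ O k) (c : ∀ k, PathCocycle (O k) (ZMod 2))
    (hc : ∀ k l {x y : X} (p : Path x y) (hk : ∀ t, p t ∈ O k) (hl : ∀ t, p t ∈ O l),
      (c k).val (p.codRestrict hk) = (c l).val (p.codRestrict hl))
    (k : κ) {x : O k} (p : Path x x) : (c k).val p = 0 := by
  have := hX.locallyPathConnectedSpace
  let ι := {i : κ × Set X × (X → ZMod 2) // IsOpen i.2.1 ∧ (c i.1).IsPotentialOn i.2.1 i.2.2}
  -- along paths in its domain, a potential computes all the cocycles
  have key : ∀ (i : ι) (k) {x y : O k} (p : Path x y), (∀ t, (p t : X) ∈ i.1.2.1) →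
      (c k).val p = i.1.2.2 y - i.1.2.2 x := by
    rintro ⟨⟨l, U, u⟩, hU, hUl, hu⟩ k x y p hp
    rw [← hu ((p.map continuous_subtype_val).codRestrict fun t => hUl (hp t)) hp,
      ← hc k l (p.map continuous_subtype_val) (fun t => (p t).2)]
    exact (c k).congr _ _ fun t => rfl
  let L : LocalPotentials X (ZMod 2) ι :=
    { baseSet := fun i => i.1.2.1
      u := fun i => i.1.2.2
      isOpen_baseSet := fun i => i.2.1
      exists_mem_baseSet := fun x => by
        obtain ⟨k, hk⟩ := hcover x
        obtain ⟨U, u, hU, hx, hu⟩ := exists_isPotentialOn hX (hO k) (c k) hk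
        exact ⟨⟨⟨k, U, u⟩, hU, hu⟩, hx⟩
      eventually_sub_eq := fun i j x hi hj => by
        have hnhds : i.1.2.1 ∩ j.1.2.1 ∈ 𝓝 x := (i.2.1.inter j.2.1).mem_nhds ⟨hi, hj⟩
        obtain ⟨V, ⟨hV, hVc⟩, hVs⟩ := (path_connected_basis x).mem_iff.mp hnhds
        filter_upwards [hV] with y hy
        obtain ⟨q, hq⟩ := hVc.joinedIn x (mem_of_mem_nhds hV) y hy
        let q' := q.codRestrict fun t => i.2.2.1 (hVs (hq t)).1
        have h1 := key i _ q' fun t => (hVs (hq t)).1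
        have h2 := key j _ q' fun t => (hVs (hq t)).2
        rw [sub_eq_sub_iff_sub_eq_sub]
        exact h1.symm.trans h2 }
  have hprim : L.IsPrimitive (fun t => (p t : X)) fun t => (c k).val (p.subpath 0 t) := by
    intro i t ht
    filter_upwards [p.eventually_subpath_mem t (i.2.1.preimage continuous_subtype_val) ht] with s hs
    rw [← (c k).subpath_add p 0 t s, key i k (p.subpath t s) hs]
    abel
  have h := LocalPotentials.IsPrimitive.apply_zero_eq_apply_one hH
    (g := ⟨fun t => (p t : X), by fun_prop⟩) (by simp) hprim
  rw [(c k).subpath_zero_one, Path.subpath_self, (c k).map_refl] at h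
  exact h.symm

end Gluing

/-- A path cocycle on a product of path connected spaces that vanishes on the loops
`{x₀} × p` differs by a coboundary from its pullback under `(x, y) ↦ (x, y₀)`. -/
theorem exists_prod_primitive {X Y A : Type*} [TopologicalSpace X] [TopologicalSpace Y]
    [AddCommGroup A] [PathConnectedSpace X] [PathConnectedSpace Y] (c : PathCocycle (X × Y) A)
    (x₀ : X) (y₀ : Y)
    (h : ∀ p : Path y₀ y₀, c.val ((Path.refl x₀).prod p) = 0) :
    ∃ u : X × Y → A, ∀ {z w : X × Y} (p : Path z w),
      c.val p = c.val (p.map (f := fun q => (q.1, y₀)) (by fun_prop)) + (u w - u z) := by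
  obtain ⟨u, hu⟩ := (c.sub (c.comap ⟨fun q => (q.1, y₀), by fun_prop⟩)).exists_primitive (x₀, y₀)
    fun p => by
      let p₁ : Path x₀ x₀ := p.map continuous_fst
      let p₂ : Path y₀ y₀ := p.map continuous_snd
      have h1 : p.Homotopic ((p₁.prod (Path.refl y₀)).trans ((Path.refl x₀).prod p₂)) := by
        rw [Path.trans_prod_eq_prod_trans]
        exact ⟨Path.Homotopic.prodHomotopy (Path.Homotopy.transRefl p₁).symm
          (Path.Homotopy.reflTrans p₂).symm⟩
      change c.val p - c.val _ = 0
      rw [c.eq_of_homotopic h1, c.map_trans, h, add_zero, sub_eq_zero]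
      exact c.congr _ _ fun t => rfl
  refine ⟨u, fun {z w} p => ?_⟩
  rw [← hu p]
  change _ = c.val _ + (c.val p - c.val _)
  rw [add_sub_cancel]

end PathCocycle

/-! ### The complement of a knot -/

theorem Complex.coe_exp_arg (z : ℂ) (hz : z ≠ 0) : (Circle.exp z.arg : ℂ) = z / ‖z‖ := by
  rw [Circle.coe_exp, eq_div_iff (by simpa using hz), mul_comm, Complex.norm_mul_exp_arg_mul_I]

theorem Complex.continuousAt_exp_arg {z : ℂ} (hz : z ≠ 0) :
    ContinuousAt (fun z : ℂ => Circle.exp z.arg) z := by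
  have hc : IsInducing fun w : Circle => (w : ℂ) := ⟨rfl⟩
  rw [hc.continuousAt_iff]
  have h : ContinuousAt (fun z : ℂ => z / ‖z‖) z :=
    continuousAt_id.div (by fun_prop) (by simpa using hz)
  refine h.congr ?_
  filter_upwards [isOpen_ne.mem_nhds hz] with w hw using (Complex.coe_exp_arg w hw).symm

namespace KnotTube

variable {W : Type u} [TopologicalSpace W] {K : Set W} (N : KnotTube K)

theorem toFun_mem_knot_iff (q : Circle × ℂ) : N.toFun q ∈ K ↔ q.2 = 0 := by
  have h := N.isOpenEmbedding.injective.mem_set_image (s := {q | q.2 = 0}) (a := q)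
  rwa [N.image_core] at h

theorem toFun_mem_complement_iff (q : Circle × ℂ) : N.toFun q ∈ N.complement ↔ 1 ≤ ‖q.2‖ := by
  rw [complement, Set.mem_compl_iff, N.isOpenEmbedding.injective.mem_set_image]
  exact not_lt (a := ‖q.2‖)

theorem exists_eq_of_notMem_complement {v : W} (hv : v ∉ N.complement) :
    ∃ q : Circle × ℂ, ‖q.2‖ < 1 ∧ N.toFun q = v := not_not.mp hv

theorem notMem_knot_of_mem_complement {v : W} (hv : v ∈ N.complement) : v ∉ K := by
  rw [← N.image_core]
  rintro ⟨q, hq, rfl⟩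
  rw [N.toFun_mem_complement_iff, show q.2 = 0 from hq, norm_zero] at hv
  exact absurd hv (by norm_num)

theorem isClosed_knot [T2Space W] (N : KnotTube K) : IsClosed K := by
  have h : K = N.toFun '' (Set.univ ×ˢ {0}) := by
    refine N.image_core.symm.trans (congrArg _ ?_)
    ext q
    simp
  rw [h]
  exact ((isCompact_univ.prod isCompact_singleton).image N.isOpenEmbedding.continuous).isClosed

/-- The boundary torus of the complement. -/
def boundary : C(Circle × Circle, N.complement) where
  toFun q := ⟨N.toFun (q.1, q.2), (N.toFun_mem_complement_iff _).mpr (Circle.norm_coe q.2).ge⟩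
  continuous_toFun := (N.isOpenEmbedding.continuous.comp (by fun_prop)).subtype_mk _

/-- The coordinates in the tube (arbitrary outside of it). -/
noncomputable def coord (v : W) : Circle × ℂ := Function.invFun N.toFun v

theorem coord_toFun (q : Circle × ℂ) : N.coord (N.toFun q) = q :=
  Function.leftInverse_invFun N.isOpenEmbedding.injective q

theorem continuousAt_coord (q : Circle × ℂ) : ContinuousAt N.coord (N.toFun q) := by
  rw [← N.isOpenEmbedding.continuousAt_iff]
  exact continuousAt_id.congr (.of_forall fun q => (N.coord_toFun q).symm)

/-- The projection of the tube to its boundary torus, away from the core: radial in the disc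
factor. -/
noncomputable def torusCoord (v : W) : Circle × Circle :=
  ((N.coord v).1, Circle.exp (N.coord v).2.arg)

theorem continuousAt_torusCoord {q : Circle × ℂ} (hq : q.2 ≠ 0) :
    ContinuousAt N.torusCoord (N.toFun q) := by
  refine (continuousAt_fst.comp (N.continuousAt_coord q)).prodMk ?_
  refine ContinuousAt.comp (g := fun z : ℂ => Circle.exp z.arg) (Complex.continuousAt_exp_arg ?_)
    (continuousAt_snd.comp (N.continuousAt_coord q))
  rwa [N.coord_toFun]

open Classical in
/-- The radial retraction of `W` minus the knot to the complement of the open tube. -/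
noncomputable def retract (v : W) : N.complement :=
  if h : v ∈ N.complement then ⟨v, h⟩ else N.boundary (N.torusCoord v)

theorem retract_of_mem {v : W} (h : v ∈ N.complement) : N.retract v = ⟨v, h⟩ := dif_pos h

theorem retract_of_notMem {v : W} (h : v ∉ N.complement) :
    N.retract v = N.boundary (N.torusCoord v) := dif_neg h

theorem continuousAt_retract [T2Space W] {v : W} (hv : v ∉ K) : ContinuousAt N.retract v := by
  rw [IsEmbedding.subtypeVal.continuousAt_iff]
  by_cases h : v ∈ N.toFun '' (Set.univ ×ˢ Metric.closedBall 0 1)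
  · obtain ⟨q, -, rfl⟩ := h
    rw [N.toFun_mem_knot_iff] at hv
    rw [← N.isOpenEmbedding.continuousAt_iff]
    have h1 : ContinuousAt (fun q : Circle × ℂ => N.toFun (q.1, q.2 / (min 1 ‖q.2‖ : ℝ))) q := by
      refine N.isOpenEmbedding.continuous.continuousAt.comp (continuousAt_fst.prodMk ?_)
      refine continuousAt_snd.div (by fun_prop) ?_
      have : 0 < min 1 ‖q.2‖ := lt_min one_pos (norm_pos_iff.mpr hv)
      exact_mod_cast this.ne'
    refine h1.congr ?_
    filter_upwards [continuousAt_snd.eventually (isOpen_ne.mem_nhds hv)] with q hq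
    by_cases hq1 : 1 ≤ ‖q.2‖
    · have := N.retract_of_mem ((N.toFun_mem_complement_iff q).mpr hq1)
      simp [this, hq1]
    · have := N.retract_of_notMem (mt (N.toFun_mem_complement_iff q).mp hq1)
      rw [Function.comp_apply, Function.comp_apply, this, torusCoord, N.coord_toFun,
        min_eq_right (not_le.mp hq1).le]
      change _ = N.toFun (q.1, (Circle.exp q.2.arg : ℂ))
      rw [Complex.coe_exp_arg _ hq]
  · have hcl : IsClosed (N.toFun '' (Set.univ ×ˢ Metric.closedBall 0 1)) :=
      ((isCompact_univ.prod (isCompact_closedBall _ _)).image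
        N.isOpenEmbedding.continuous).isClosed
    refine continuousAt_id.congr ?_
    filter_upwards [hcl.isOpen_compl.mem_nhds h] with w hw
    have hw1 : w ∈ N.complement := by
      rintro ⟨q, hq, rfl⟩
      exact hw ⟨q, ⟨trivial, by simpa using le_of_lt hq⟩, rfl⟩
    rw [Function.comp_apply, N.retract_of_mem hw1, id]

theorem isPreconnected_compl [T2Space W] [PreconnectedSpace W] (N : KnotTube K) : IsPreconnected Kᶜ := by
  classical
  -- a locally constant function off the knot is constant on the tube minus the knot, so it extends
  refine isPreconnected_of_forall_constant fun f hf x hx y hy => ?_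
  let T : Set (Circle × ℂ) := Set.univ ×ˢ {0}ᶜ
  have hT : IsPreconnected T := isPreconnected_univ.prod
    (isConnected_compl_singleton_of_one_lt_rank (by simp) 0).isPreconnected
  have hmem : ∀ q : Circle × ℂ, q.2 ≠ 0 → q ∈ T ∧ N.toFun q ∈ Kᶜ := fun q hq =>
    ⟨⟨trivial, hq⟩, mt (N.toFun_mem_knot_iff q).mp hq⟩
  have hfT : ∀ q : Circle × ℂ, q.2 ≠ 0 → f (N.toFun q) = f (N.toFun (1, 1)) := fun q hq =>
    hT.constant_of_mapsTo IsDiscrete.univ (f := f ∘ N.toFun)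
      (hf.comp N.isOpenEmbedding.continuous.continuousOn fun q hq => (hmem q hq.2).2)
      (fun _ _ => trivial) (hmem q hq).1 (hmem (1, 1) one_ne_zero).1
  let g : W → Bool := fun v => if v ∈ K then f (N.toFun (1, 1)) else f v
  have hg : Continuous g := continuous_iff_continuousAt.mpr fun v => by
    by_cases hv : v ∈ K
    · obtain ⟨q, -, rfl⟩ := N.image_core.symm ▸ hv
      rw [← N.isOpenEmbedding.continuousAt_iff]
      refine (continuousAt_const (y := f (N.toFun (1, 1)))).congr (.of_forall fun q => ?_)
      by_cases hq : q.2 = 0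
      · simp [g, N.toFun_mem_knot_iff, hq]
      · simp [g, N.toFun_mem_knot_iff, hq, hfT q hq]
    · have hO := N.isClosed_knot.isOpen_compl.mem_nhds hv
      refine (hf.continuousAt hO).congr ?_
      filter_upwards [hO] with w hw using (if_neg hw).symm
  have h := PreconnectedSpace.constant ‹_› hg (x := x) (y := y)
  simpa only [g, if_neg hx, if_neg hy] using h

theorem pathConnectedSpace_complement [T2Space W] [PreconnectedSpace W]
    [LocallyPathConnectedSpace W] : PathConnectedSpace N.complement := by
  have h1 : IsPathConnected Kᶜ :=
    N.isClosed_knot.isOpen_compl.isConnected_iff_isPathConnected.mp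
      ⟨⟨N.toFun (1, 1), mt (N.toFun_mem_knot_iff _).mp one_ne_zero⟩, N.isPreconnected_compl⟩
  have := isPathConnected_iff_pathConnectedSpace.mp h1
  refine Function.Surjective.pathConnectedSpace (f := fun v : (Kᶜ : Set W) => N.retract v)
    (fun m => ⟨⟨m, N.notMem_knot_of_mem_complement m.2⟩, N.retract_of_mem m.2⟩) ?_
  exact continuous_iff_continuousAt.mpr fun v =>
    (N.continuousAt_retract v.2).comp continuousAt_subtype_val

/-- If `H₁(W; ℤ/2) = 0`, then a class of the knot complement with coefficients in `ℤ/2` that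
vanishes on the meridian loops of the boundary torus vanishes. On the tube minus the knot it differs
by a coboundary from the pullback of its restriction to the longitude, which extends over the
knot. -/
theorem pathCocycle_eq_zero [T2Space W] (hX : HasSimplyConnectedBasis W)
    (hH : Subsingleton (HomologyModTwo 1 W)) (c : PathCocycle N.complement (ZMod 2))
    (hc : ∀ p : Path (1 : Circle) 1,
      c.val (((Path.refl (1 : Circle)).prod p).map N.boundary.continuous) = 0)
    {x : N.complement} (p : Path x x) : c.val p = 0 := by
  obtain ⟨u, hu⟩ := (c.comap N.boundary).exists_prod_primitive 1 1 hc
  -- the pullback along the retraction, and the extension over the open tube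
  let O : Bool → Set W := fun b => bif b then Kᶜ else N.complementᶜ
  let r : C(O true, N.complement) := ⟨fun v => N.retract v, continuous_iff_continuousAt.mpr
    fun v => (N.continuousAt_retract v.2).comp continuousAt_subtype_val⟩
  let s : C(O false, N.complement) := ⟨fun v => N.boundary ((N.coord v).1, 1), by
    refine N.boundary.continuous.comp (Continuous.prodMk ?_ continuous_const)
    refine continuous_iff_continuousAt.mpr fun v => ?_
    obtain ⟨q, -, hq⟩ := N.exists_eq_of_notMem_complement v.2
    refine continuousAt_fst.comp (ContinuousAt.comp ?_ continuousAt_subtype_val)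
    rw [← hq]
    exact N.continuousAt_coord q⟩
  let c' : ∀ b, PathCocycle (O b) (ZMod 2) := fun b => match b with
    | true => c.comap r
    | false => (c.comap s).addCoboundary fun v => u (N.torusCoord v)
  have hagree : ∀ {y z : W} (p : Path y z) (hk : ∀ t, p t ∈ O true) (hl : ∀ t, p t ∈ O false),
      (c' true).val (p.codRestrict hk) = (c' false).val (p.codRestrict hl) := by
    intro y z p hk hl
    have hcont : Continuous fun t => N.torusCoord (p t) := by
      refine continuous_iff_continuousAt.mpr fun t => ?_
      obtain ⟨q, -, hq⟩ := N.exists_eq_of_notMem_complement (hl t)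
      refine ContinuousAt.comp (g := N.torusCoord) ?_ p.continuous.continuousAt
      have h1 := hk t
      rw [← hq] at h1 ⊢
      exact N.continuousAt_torusCoord (mt (N.toFun_mem_knot_iff q).mpr h1)
    let q : Path (N.torusCoord y) (N.torusCoord z) :=
      { toFun := fun t => N.torusCoord (p t), source' := by simp, target' := by simp }
    have h1 : (c' true).val (p.codRestrict hk) = (c.comap N.boundary).val q :=
      c.congr _ _ fun t => N.retract_of_notMem (hl t)
    rw [h1, hu q]
    rfl
  have h := PathCocycle.eq_zero_of_agree hX hH (O := O)
    (fun b => by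
      cases b
      · simp only [O, cond_false, complement, compl_compl]
        exact N.isOpenEmbedding.isOpenMap _ (isOpen_lt (by fun_prop) continuous_const)
      · exact N.isClosed_knot.isOpen_compl)
    (fun v => by
      by_cases hv : v ∈ N.complement
      · exact ⟨true, N.notMem_knot_of_mem_complement hv⟩
      · exact ⟨false, hv⟩)
    c'
    (fun k l {y z} p hk hl => by
      cases k <;> cases l
      · rfl
      · exact (hagree p hl hk).symm
      · exact hagree p hk hl
      · rfl)
    true
    (p.map (f := fun v => (⟨v, N.notMem_knot_of_mem_complement v.2⟩ : O true)) (by fun_prop))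
  rw [← h]
  exact c.congr _ _ fun t => (N.retract_of_mem (p t).2).symm

/-- The meridian of a knot in a `ℤ/2`-homology sphere detects the homomorphisms from the
fundamental group of the knot complement to `ℤ/2`. -/
theorem exists_meridian [T2Space W] (hX : HasSimplyConnectedBasis W)
    (hH : Subsingleton (HomologyModTwo 1 W)) [PathConnectedSpace N.complement]
    (x : N.complement) : ∃ μ : FundamentalGroup N.complement x,
      ∀ f : FundamentalGroup N.complement x →* Multiplicative (ZMod 2), f μ = 1 → f = 1 := by
  obtain ⟨g, hg⟩ := (isCyclic_fundamentalGroup_circle 1).exists_generator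
  obtain ⟨m, rfl⟩ := Path.Homotopic.Quotient.mk_surjective g
  let j : C(Circle, N.complement) := N.boundary.comp ⟨fun w => (1, w), by fun_prop⟩
  let δ : Path x (j 1) := PathConnectedSpace.somePath _ _
  refine ⟨FundamentalGroup.fromPath (.mk ((δ.trans (m.map j.continuous)).trans δ.symm)),
    fun f hf => ?_⟩
  obtain ⟨c, rfl⟩ := PathCocycle.exists_toHom_eq x f
  have h1 : (c.comap j).val m = 0 := by
    have : c.val ((δ.trans (m.map j.continuous)).trans δ.symm) = 0 := hf
    rw [c.map_trans, c.map_trans, c.map_symm] at this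
    rw [PathCocycle.comap_val]
    linear_combination this
  have h2 : ∀ p : Path (1 : Circle) 1, (c.comap j).val p = 0 := fun p => by
    obtain ⟨n, hn⟩ := Subgroup.mem_zpowers_iff.mp (hg (FundamentalGroup.fromPath (.mk p)))
    have h3 : (c.comap j).toHom 1 (FundamentalGroup.fromPath (.mk m)) = 1 := h1
    have h4 : (c.comap j).toHom 1 (FundamentalGroup.fromPath (.mk p)) = 1 := by
      rw [← hn, map_zpow]
      exact (congrArg (· ^ n) h3).trans (one_zpow n)
    exact h4
  ext1 g
  induction g using Quotient.inductionOn with | _ p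
  exact N.pathCocycle_eq_zero hX hH c
    (fun q => (c.congr _ _ fun t => rfl).trans (h2 q)) p

end KnotTube

/-! ### Integrality -/

theorem mainTheorem6 {W : Type u} [TopologicalSpace W] (hW : IsModTwoHomologyThreeSphere W)
    (K : Set W) (N : KnotTube K) (hfib : FibersOverCircle N.complement)
    (x : N.complement) (ρ : FundamentalGroup N.complement x →* PSLTwoC)
    (hna : IsNonabelianRep ρ) (hred : IsReducibleRep ρ) :
    IsIntegralRep ρ := by
  have := hW.t2
  have := hW.connected
  obtain ⟨hchart⟩ := hW.manifold
  have hX : HasSimplyConnectedBasis W := .of_chartedSpace (hasSimplyConnectedBasis_euclideanSpace 3)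
  have := hX.locallyPathConnectedSpace
  have := N.pathConnectedSpace_complement
  obtain ⟨μ, hμ⟩ := N.exists_meridian hX (hW.homology_other 1 (by norm_num) (by norm_num)) x
  obtain ⟨F, _, p, _, _, ⟨_⟩, hloc⟩ := hfib
  obtain ⟨ε, hε, hfg⟩ := exists_hom_int_fg_ker
    (.of_chartedSpace (hasSimplyConnectedBasis_euclideanHalfSpace 2)) hloc x
  exact isIntegralRep_of_fg_ker ε hε hfg μ hμ ρ hna hred
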